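/- \textbf{Setting.} Let $d\ge 1$, $f:\mathbb{R}^d\to\mathbb{R}$ twice differentiable, $\|\cdot\|$ the Euclidean norm on vectors and the spectral norm on matrices. For $\alpha,\gamma,\nu,r>0$, $f$ is \emph{$(\alpha,\gamma,\nu,r)$-strict-saddle} if for every $x\in\mathbb{R}^d$ at least one of the following holds: (1) $\|\nabla f(x)\|\ge\nu$; (2) $\lambda_{\min}(\nabla^2 f(x))\le-\gamma$; (3) there is a local minimum $x^*$ of $f$ with $\|x-x^*\|\le r$ such that $f$ is $\alpha$-strongly convex on the $2r$-neighbourhood of $x^*$, i.e. $f(z)-f(y)\ge\nabla f(y)^\top(z-y)+\frac{\alpha}{2}\|z-y\|^2$ for all $y,z$ in it. It is \emph{$\beta$-smooth} if $\|\nabla f(x)-\nabla f(y)\|\le\beta\|x-y\|$, and has \emph{$\rho$-Lipschitz Hessian} if $\|\nabla^2 f(x)-\nabla^2 f(y)\|\le\rho\|x-y\|$, for all $x,y$. \emph{Saddle-NGD} with learning rate $\eta$, noise level $\theta$, noise period $N_0$ and starting point $x_0$ is $$x_{t+1}=x_t-\eta\,\frac{\nabla f(x_t)}{\|\nabla f(x_t)\|}+\theta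 n_t,\qquad t=0,1,2,\dots,$$ where $n_t\sim\mathcal N(0,I_d)$ if $N_0$ divides $t$ (these being independent), $n_t=0$ otherwise, and the normalized gradient is read as $0$ when $\nabla f(x_t)=0$. \textbf{Notation.} For $C\ge1$ and $k\in\mathbb N$ put $$M=(1+\log d)\Big(1+\log\tfrac1\xi\Big)\prod_{p\in\{\alpha,\gamma,\nu,r,\beta,\rho,B\}}\Big(p+\tfrac1p\Big),\qquad L=C\Big(M\big(1+\log\tfrac1\eta\big)\Big)^k,\qquad \eta_{\max}=\frac{1}{C\,M^k\,d^2}.$$ So $L$ is a factor polynomial in the parameters, their inverses, $\log(1/\eta)$, $\log d$ and $\log(1/\xi)$. Here $X=\tilde O(Y)$ means $X\le L\,Y$, and $X=\tilde\Theta(Y)$ means $Y/L\le X\le L\,Y$. \textbf{Theorem 1.} There are universal constants $C\ge1$ and $k\in\mathbb N$ such that the following holds for all $\alpha,\gamma,\nu,r,\beta,\rho,B>0$, all $d\ge1$, all $\xi\in(0,1)$ and all $\eta\in(0,\eta_{\max})$. There are a noise level $\theta=\tilde\Theta(\eta)$, a noise period $N_0=\tilde\Theta(\eta^{-1/2})$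 and a number of steps $T_{\mathrm{tot}}=\tilde O(\eta^{-3/2})$, depending only on $\alpha,\gamma,\nu,r,\beta,\rho,B,d,\xi,\eta$, such that for every $f:\mathbb{R}^d\to\mathbb{R}$ that is $(\alpha,\gamma,\nu,r)$-strict-saddle, $\beta$-smooth, has $\rho$-Lipschitz Hessian and satisfies $|f(x)|\le B$ for all $x$, and for every starting point $x_0\in\mathbb{R}^d$, with probability at least $1-\xi$ there is a local minimum $x^*$ of $f$ for which Saddle-NGD satisfies $$\|x_t-x^*\|\le\tilde O(\sqrt\eta)\ \text{ for some } t\le T_{\mathrm{tot}},\qquad\text{and}\qquad f(x_{T_{\mathrm{tot}}})-f(x^*)\le\tilde O(\eta).$$ -/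

import Mathlib

open MeasureTheory ProbabilityTheory

namespace SaddleNGD

/-- `ℝ^d` with the Euclidean norm. -/
abbrev Vec (d : ℕ) : Type := EuclideanSpace ℝ (Fin d)

noncomputable section

/-- The Hessian of `f` at `x`, as the derivative of the gradient; the norm on `→L` is the
spectral norm. -/
def hessian {d : ℕ} (f : Vec d → ℝ) (x : Vec d) : Vec d →L[ℝ] Vec d :=
  fderiv ℝ (gradient f) x

/-- `f` is `β`-smooth. -/
def IsSmooth {d : ℕ} (β : ℝ) (f : Vec d → ℝ) : Prop :=
  Differentiable ℝ f ∧ ∀ x y : Vec d, ‖gradient f x - gradient f y‖ ≤ β * ‖x - y‖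

/-- `f` is twice differentiable (necessarily `C²`) with a `ρ`-Lipschitz Hessian. -/
def HasLipschitzHessian {d : ℕ} (ρ : ℝ) (f : Vec d → ℝ) : Prop :=
  ContDiff ℝ 2 f ∧ ∀ x y : Vec d, ‖hessian f x - hessian f y‖ ≤ ρ * ‖x - y‖

/-- `f` is `α`-strongly convex on the set `s`, in the first-order form. -/
def IsStronglyConvexOn {d : ℕ} (α : ℝ) (f : Vec d → ℝ) (s : Set (Vec d)) : Prop :=
  ∀ x ∈ s, ∀ y ∈ s, inner ℝ (gradient f x) (y - x) + α / 2 * ‖x - y‖ ^ 2 ≤ f y - f x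

/-- `f` is `(α, γ, ν, r)`-strict-saddle. The second alternative says that the smallest eigenvalue
of the Hessian at `x` is at most `-γ`. -/
def IsStrictSaddle {d : ℕ} (α γ ν r : ℝ) (f : Vec d → ℝ) : Prop :=
  ∀ x : Vec d,
    ν ≤ ‖gradient f x‖ ∨
    (∃ μ : ℝ, μ ≤ -γ ∧ Module.End.HasEigenvalue (hessian f x : Vec d →ₗ[ℝ] Vec d) μ) ∨
    (∃ xs : Vec d, IsLocalMin f xs ∧ ‖x - xs‖ ≤ r ∧
      IsStronglyConvexOn α f (Metric.closedBall xs (2 * r)))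

/-- The normalized gradient `∇f(x) / ‖∇f(x)‖`, read as `0` at a critical point. -/
def normalizedGradient {d : ℕ} (f : Vec d → ℝ) (x : Vec d) : Vec d :=
  ‖gradient f x‖⁻¹ • gradient f x

/-- The iterates of Saddle-NGD with learning rate `η`, noise level `θ`, noise period `N₀`,
starting point `x₀` and noise vectors `n 0, n 1, …`, of which only those with index divisible by
`N₀` are used. -/
def iterate {d : ℕ} (f : Vec d → ℝ) (η θ : ℝ) (N₀ : ℕ) (x₀ : Vec d) (n : ℕ → Vec d) :
    ℕ → Vec d
  | 0 => x₀
  | t + 1 =>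
      iterate f η θ N₀ x₀ n t - η • normalizedGradient f (iterate f η θ N₀ x₀ n t)
        + θ • (if t % N₀ = 0 then n t else 0)

/-- The numerical parameters of the function class. -/
structure Params where
  (α γ ν r β ρ B : ℝ)

/-- All parameters are positive. -/
def Params.Pos (P : Params) : Prop :=
  0 < P.α ∧ 0 < P.γ ∧ 0 < P.ν ∧ 0 < P.r ∧ 0 < P.β ∧ 0 < P.ρ ∧ 0 < P.B

/-- The function class: strict-saddle, smooth, Lipschitz Hessian, bounded. -/
def Params.Admits (P : Params) {d : ℕ} (f : Vec d → ℝ) : Prop :=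
  IsStrictSaddle P.α P.γ P.ν P.r f ∧ IsSmooth P.β f ∧ HasLipschitzHessian P.ρ f ∧
    ∀ x : Vec d, |f x| ≤ P.B

/-- A quantity that dominates each of the parameters, its inverse, `log d` and `log (1/ξ)`. -/
def baseSize (P : Params) (d : ℕ) (ξ : ℝ) : ℝ :=
  (P.α + P.α⁻¹) * (P.γ + P.γ⁻¹) * (P.ν + P.ν⁻¹) * (P.r + P.r⁻¹) * (P.β + P.β⁻¹) *
    (P.ρ + P.ρ⁻¹) * (P.B + P.B⁻¹) * (1 + Real.log d) * (1 + Real.log (1 / ξ))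

/-- The largest learning rate: `1 / d²` up to a polynomial in the parameters, their inverses,
`log d` and `log (1/ξ)`. -/
def etaMax (C : ℝ) (k : ℕ) (P : Params) (d : ℕ) (ξ : ℝ) : ℝ :=
  1 / (C * baseSize P d ξ ^ k * (d : ℝ) ^ 2)

/-- The factor hidden by the tilde in `Õ`, `Θ̃`: a polynomial in the parameters, their inverses,
`log (1/η)`, `log d` and `log (1/ξ)`. -/
def tildeFactor (C : ℝ) (k : ℕ) (P : Params) (d : ℕ) (ξ η : ℝ) : ℝ :=
  C * (baseSize P d ξ * (1 + Real.log (1 / η))) ^ k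

/-- `X = Õ(Y)` with hidden factor `L`. -/
def IsTildeO (L X Y : ℝ) : Prop := X ≤ L * Y

/-- `X = Θ̃(Y)` with hidden factor `L`. -/
def IsTildeTheta (L X Y : ℝ) : Prop := Y / L ≤ X ∧ X ≤ L * Y

end

end SaddleNGD

open SaddleNGD

/-! ### Smoothness estimates and the division of the run into blocks. -/

namespace SaddleNGD

/-! Write `s = √η` and `A = M (1 + log (1/η))`; `A` dominates every parameter, its inverse and all
the logarithms involved. The run is cut into blocks of `N ≈ A²/s` steps, each opened by one noise
vector. With high probability all these vectors are mild, so a block travels only `O(A² s)`, a scale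
at which the Hessian is nearly constant. A block can start at three kinds of point.

If the gradient is at least `A⁴ s`, it keeps half its size throughout the block, and the descent
lemma gives a decrease of at least `η` (`Scales.block_le_of_large_gradient`). Within `A⁵ s` of a
strongly convex minimum, the normalized steps win back more than the noise loses, so this
neighbourhood is absorbing (`Scales.norm_block_sub_le`). At any other point the gradient is small
and the Hessian has a unit eigenvector `u` with eigenvalue at most `-γ`
(`Scales.gradient_or_saddle`). Since each step gains about `η ‖∇f‖`, a block that fails to lose `η`
there has gradient norms summing to at most `2`. But a normalized step multiplies `⟨u, ∇f⟩` by at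
least `1 + γη/‖∇f‖`, up to a small error, so gradients that are small on average force growth by a
factor `e^{3A}` (`mul_exp_le_of_growth`). The gradient stays below `1`, so the component along `u`
was tiny at the outset, which confines the noise to a slab of Gaussian measure at most `1/16`
(`Scales.mem_slab_of_not_decrease`, `stdGaussian_slab_le`).

Away from the minima a failing mild block costs at most `η/16`. An exponential moment
(`measure_half_bad_le`) shows that fewer than half of `K ≈ A²/η` blocks fail, except with
probability `2⁻ᴷ`. A run that never entered the absorbing neighbourhood would then lower `f` by more
than `2B`, which is impossible. Hence the last iterate is near a minimum; this gives the distance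
bound, and smoothness gives the bound on the value. -/

theorem norm_fderiv_sub {d : ℕ} (f : Vec d → ℝ) (x y : Vec d) :
    ‖fderiv ℝ f x - fderiv ℝ f y‖ = ‖gradient f x - gradient f y‖ := by
  rw [← toDual_gradient, ← toDual_gradient, ← map_sub, LinearIsometryEquiv.norm_map]

theorem IsSmooth.continuous_gradient {d : ℕ} {β : ℝ} {f : Vec d → ℝ} (hf : IsSmooth β f) :
    Continuous (gradient f) := by
  have : LipschitzWith β.toNNReal (gradient f) := by
    refine LipschitzWith.of_dist_le_mul fun x y => ?_
    rw [dist_eq_norm, dist_eq_norm]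
    refine (hf.2 x y).trans ?_
    gcongr
    exact Real.le_coe_toNNReal β
  exact this.continuous

/-- The descent lemma, with the constant `β` in place of `β / 2`. -/
theorem IsSmooth.abs_sub_sub_inner_le {d : ℕ} {β : ℝ} (hβ : 0 ≤ β) {f : Vec d → ℝ}
    (hf : IsSmooth β f) (x y : Vec d) :
    |f y - f x - inner ℝ (gradient f x) (y - x)| ≤ β * ‖y - x‖ ^ 2 := by
  have h := (convex_closedBall x ‖y - x‖).norm_image_sub_le_of_norm_fderiv_le' (𝕜 := ℝ) (f := f)
    (φ := fderiv ℝ f x) (C := β * ‖y - x‖) (fun z _ => hf.1 z) (fun z hz => by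
      rw [norm_fderiv_sub]
      refine (hf.2 z x).trans ?_
      gcongr
      simpa [dist_eq_norm] using hz) (Metric.mem_closedBall_self (norm_nonneg _))
      (show y ∈ _ by simp [dist_eq_norm])
  rw [← inner_gradient_left, Real.norm_eq_abs] at h
  linarith

theorem differentiable_gradient {d : ℕ} {f : Vec d → ℝ} (hf : ContDiff ℝ 2 f) :
    Differentiable ℝ (gradient f) := by
  have h : Differentiable ℝ (fderiv ℝ f) :=
    (hf.fderiv_right (m := 1) (by norm_num)).differentiable (by norm_num)
  exact (InnerProductSpace.toDual ℝ (Vec d)).symm.toContinuousLinearEquiv.toContinuousLinearMap.differentiable.comp h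

theorem inner_hessian_apply {d : ℕ} {f : Vec d → ℝ} (hf : ContDiff ℝ 2 f) (x u v : Vec d) :
    inner ℝ (hessian f x u) v = fderiv ℝ (fderiv ℝ f) x u v := by
  have h : Differentiable ℝ (fderiv ℝ f) :=
    (hf.fderiv_right (m := 1) (by norm_num)).differentiable (by norm_num)
  have h1 : HasFDerivAt (gradient f) (((InnerProductSpace.toDual ℝ
      (Vec d)).symm.toContinuousLinearEquiv.toContinuousLinearMap) ∘L fderiv ℝ (fderiv ℝ f) x) x :=
    ((InnerProductSpace.toDual ℝ
      (Vec d)).symm.toContinuousLinearEquiv.toContinuousLinearMap).hasFDerivAt.comp x (h x).hasFDerivAt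
  rw [hessian, h1.fderiv]
  exact InnerProductSpace.toDual_symm_apply

theorem inner_hessian_comm {d : ℕ} {f : Vec d → ℝ} (hf : ContDiff ℝ 2 f) (x u v : Vec d) :
    inner ℝ u (hessian f x v) = inner ℝ (hessian f x u) v := by
  rw [real_inner_comm, inner_hessian_apply hf, inner_hessian_apply hf]
  exact (hf.contDiffAt.isSymmSndFDerivAt (by simp)).eq v u

/-- Mean value inequality with the Hessian frozen at `x₀`, not at `x`: a single eigenvector, taken
at the start of a block, then serves for all its steps. -/
theorem HasLipschitzHessian.norm_gradient_sub_sub_le {d : ℕ} {ρ : ℝ} (hρ : 0 ≤ ρ) {f : Vec d → ℝ}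
    (hf : HasLipschitzHessian ρ f) (x₀ x y : Vec d) (R : ℝ) (hx : ‖x - x₀‖ ≤ R)
    (hy : ‖y - x₀‖ ≤ R) :
    ‖gradient f y - gradient f x - hessian f x₀ (y - x)‖ ≤ ρ * R * ‖y - x‖ := by
  refine (convex_closedBall x₀ R).norm_image_sub_le_of_norm_fderiv_le' (𝕜 := ℝ)
    (fun z _ => differentiable_gradient hf.1 z) (fun z hz => (hf.2 z x₀).trans ?_) ?_ ?_
  · gcongr
    simpa [dist_eq_norm] using hz
  · simpa [dist_eq_norm] using hx
  · simpa [dist_eq_norm] using hy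

theorem norm_normalizedGradient_le {d : ℕ} (f : Vec d → ℝ) (x : Vec d) :
    ‖normalizedGradient f x‖ ≤ 1 := by
  rw [normalizedGradient, norm_smul, norm_inv, norm_norm]
  exact inv_mul_le_one

theorem inner_gradient_normalizedGradient {d : ℕ} (f : Vec d → ℝ) (x : Vec d) :
    inner ℝ (gradient f x) (normalizedGradient f x) = ‖gradient f x‖ := by
  rw [normalizedGradient, inner_smul_right, real_inner_self_eq_norm_sq]
  by_cases h : ‖gradient f x‖ = 0
  · simp [h]
  · field_simp

theorem IsSmooth.measurable_normalizedGradient {d : ℕ} {β : ℝ} {f : Vec d → ℝ}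
    (hf : IsSmooth β f) : Measurable (normalizedGradient f) := by
  have := hf.continuous_gradient.measurable
  unfold normalizedGradient
  fun_prop

/-- One noiseless step decreases the function up to a second-order error. -/
theorem IsSmooth.step_le {d : ℕ} {β η : ℝ} (hβ : 0 ≤ β) (hη : 0 ≤ η) {f : Vec d → ℝ}
    (hf : IsSmooth β f) (x : Vec d) :
    f (x - η • normalizedGradient f x) ≤ f x - η * ‖gradient f x‖ + β * η ^ 2 := by
  have h := (abs_le.1 (hf.abs_sub_sub_inner_le hβ x (x - η • normalizedGradient f x))).2
  have h1 : x - η • normalizedGradient f x - x = -(η • normalizedGradient f x) := by abel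
  rw [h1, inner_neg_right, inner_smul_right, inner_gradient_normalizedGradient, norm_neg,
    norm_smul, Real.norm_of_nonneg hη] at h
  have h2 : β * (η * ‖normalizedGradient f x‖) ^ 2 ≤ β * (η * 1) ^ 2 := by
    gcongr
    exact norm_normalizedGradient_le f x
  rw [mul_one] at h2
  linarith

/-- The endpoint of a block of `N` steps whose first step carries the noise vector `v`. -/
noncomputable def block {d : ℕ} (f : Vec d → ℝ) (η θ : ℝ) (N : ℕ) (x v : Vec d) : Vec d :=
  iterate f η θ N x (fun _ => v) N

/-- Inside a block only step `0` reads the noise, so the constant sequence `n (k * N)` can replace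
the true one; `j = N` is allowed because the step that produces it has index `N - 1`. -/
theorem iterate_mul_add {d : ℕ} (f : Vec d → ℝ) (η θ : ℝ) (N : ℕ) (x₀ : Vec d) (n : ℕ → Vec d)
    (k j : ℕ) (hj : j ≤ N) :
    iterate f η θ N x₀ n (k * N + j) =
      iterate f η θ N (iterate f η θ N x₀ n (k * N)) (fun _ => n (k * N)) j := by
  induction j with
  | zero => simp [iterate]
  | succ j ih =>
    rw [← add_assoc, iterate, iterate, ih (by omega)]
    have hj' : j % N = j := Nat.mod_eq_of_lt (by omega)
    have : (k * N + j) % N = j := by rw [Nat.mul_add_mod_self_right, hj']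
    rw [this, hj']
    by_cases h : j = 0 <;> simp [h]

theorem iterate_succ_mul {d : ℕ} (f : Vec d → ℝ) (η θ : ℝ) (N : ℕ) (x₀ : Vec d) (n : ℕ → Vec d)
    (k : ℕ) :
    iterate f η θ N x₀ n ((k + 1) * N) =
      block f η θ N (iterate f η θ N x₀ n (k * N)) (n (k * N)) := by
  rw [add_mul, one_mul, iterate_mul_add f η θ N x₀ n k N le_rfl, block]

theorem iterate_one {d : ℕ} (f : Vec d → ℝ) (η θ : ℝ) (N : ℕ) (x v : Vec d) :
    iterate f η θ N x (fun _ => v) 1 = x - η • normalizedGradient f x + θ • v := by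
  simp [iterate]

theorem iterate_succ_of_pos {d : ℕ} (f : Vec d → ℝ) (η θ : ℝ) (N : ℕ) (x v : Vec d) (t : ℕ)
    (ht : 0 < t) (htN : t < N) :
    iterate f η θ N x (fun _ => v) (t + 1) =
      iterate f η θ N x (fun _ => v) t -
        η • normalizedGradient f (iterate f η θ N x (fun _ => v) t) := by
  rw [iterate, Nat.mod_eq_of_lt htN, if_neg ht.ne', smul_zero, add_zero]

theorem IsSmooth.measurable_iterate {d : ℕ} {β : ℝ} {f : Vec d → ℝ} (hf : IsSmooth β f)
    (η θ : ℝ) (N t : ℕ) :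
    Measurable fun p : Vec d × Vec d => iterate f η θ N p.1 (fun _ => p.2) t := by
  induction t with
  | zero => exact measurable_fst
  | succ t ih =>
    simp only [iterate]
    have := hf.measurable_normalizedGradient
    split_ifs <;> fun_prop

theorem norm_iterate_sub_le {d : ℕ} (f : Vec d → ℝ) {η θ : ℝ} (hη : 0 ≤ η) (hθ : 0 ≤ θ) (N : ℕ)
    (x v : Vec d) (t : ℕ) (ht : t ≤ N) :
    ‖iterate f η θ N x (fun _ => v) t - x‖ ≤ t * η + θ * ‖v‖ := by
  induction t with
  | zero => simp [iterate]; positivity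
  | succ t ih =>
    have hg : ∀ z, ‖η • normalizedGradient f z‖ ≤ η := fun z => by
      rw [norm_smul, Real.norm_of_nonneg hη]
      exact mul_le_of_le_one_right hη (norm_normalizedGradient_le f z)
    rcases Nat.eq_zero_or_pos t with rfl | h0
    · rw [zero_add, iterate_one]
      have : x - η • normalizedGradient f x + θ • v - x
        = -(η • normalizedGradient f x) + θ • v := by abel
      rw [this]
      refine (norm_add_le _ _).trans ?_
      rw [norm_neg, norm_smul θ, Real.norm_of_nonneg hθ]
      simpa using hg x
    · rw [iterate_succ_of_pos f η θ N x v t h0 (by omega)]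
      have h := ih (by omega)
      set z := iterate f η θ N x (fun _ => v) t
      have : z - η • normalizedGradient f z - x = (z - x) - η • normalizedGradient f z := by abel
      rw [this]
      refine (norm_sub_le _ _).trans ?_
      push_cast
      linarith [hg z]

end SaddleNGD

/-! ### Change of the function over one block, and a discrete growth estimate. -/

namespace SaddleNGD

/-- The relations between the parameters of the function class, a size `A` bounding them and their
inverses, the square root `s` of the learning rate, the noise level and the noise period. -/
structure Scales (P : Params) (A s θ : ℝ) (N : ℕ) : Prop where
  hA : 128 ≤ A
  hβ : 0 < P.β
  hρ : 0 < P.ρ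
  α_inv : 1 ≤ A * P.α
  γ_inv : 1 ≤ A * P.γ
  γ_le : P.γ ≤ A
  ν_inv : 1 ≤ A * P.ν
  r_inv : 1 ≤ A * P.r
  β_le : P.β ≤ A
  ρ_le : P.ρ ≤ A
  B_le : P.B ≤ A
  s_pos : 0 < s
  hθ : θ = A ^ 8 * s ^ 2
  le_N : A ^ 2 ≤ N * s
  N_le : N * s ≤ 2 * A ^ 2
  small : s * A ^ 20 ≤ 1
  exp_le : Real.exp (-A) ≤ s

/-- The noise vector `v` moves the iterate by less than the natural length scale `s`. -/
def IsMild {d : ℕ} (A s θ : ℝ) (v : Vec d) : Prop := (s ^ 2 + θ * ‖v‖) * A ^ 5 ≤ s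

namespace Scales

variable {P : Params} {A s θ : ℝ} {N : ℕ}

theorem θ_nonneg (h : Scales P A s θ N) : 0 ≤ θ := by
  have := h.hA
  rw [h.hθ]
  positivity

theorem small_of_le (h : Scales P A s θ N) {m : ℕ} (hm : m ≤ 19) : s * A ^ m ≤ 1 / 128 := by
  have hA := h.hA
  have h1 : A ^ (m + 1) ≤ A ^ 20 := pow_le_pow_right₀ (by linarith) (by omega)
  have h2 : s * A ^ (m + 1) ≤ 1 := (mul_le_mul_of_nonneg_left h1 h.s_pos.le).trans h.small
  have h3 : 0 ≤ s * A ^ m := mul_nonneg h.s_pos.le (by positivity)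
  have h4 : s * A ^ (m + 1) = s * A ^ m * A := by ring
  nlinarith

theorem four_le_N (h : Scales P A s θ N) : 4 ≤ N := by
  have hs := h.small_of_le (m := 0) (by norm_num)
  have h1 := h.le_N
  have hA := h.hA
  by_contra hN
  have h2 : (N : ℝ) ≤ 4 := by exact_mod_cast (by omega : N ≤ 4)
  have := h.s_pos
  nlinarith

theorem mild_sq (h : Scales P A s θ N) {d : ℕ} {v : Vec d} (hv : IsMild A s θ v) :
    A * (s ^ 2 + θ * ‖v‖) ^ 2 ≤ s ^ 2 / 64 := by
  have hA := h.hA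
  have hs := h.s_pos
  have hθ := h.θ_nonneg
  rw [IsMild] at hv
  set κ := s ^ 2 + θ * ‖v‖
  have hκ : 0 ≤ κ := by positivity
  have h1 : (64 : ℝ) ≤ A ^ 4 := by
    have : (128 : ℝ) ^ 4 ≤ A ^ 4 := by gcongr
    linarith
  have h2 : 64 * (A * κ) ≤ s := by
    calc 64 * (A * κ) ≤ A ^ 4 * (A * κ) := by gcongr
      _ = κ * A ^ 5 := by ring
      _ ≤ s := hv
  have h3 : κ ≤ s := by nlinarith
  calc A * κ ^ 2 = (64 * (A * κ)) * κ / 64 := by ring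
    _ ≤ s * s / 64 := by gcongr
    _ = s ^ 2 / 64 := by ring

theorem mild_le (h : Scales P A s θ N) {d : ℕ} {v : Vec d} (hv : IsMild A s θ v) :
    s ^ 2 + θ * ‖v‖ ≤ s / 8 := by
  have hA := h.hA
  have hs := h.s_pos
  have hθ := h.θ_nonneg
  rw [IsMild] at hv
  have hκ : 0 ≤ s ^ 2 + θ * ‖v‖ := by positivity
  have h1 : (8 : ℝ) ≤ A ^ 5 := by
    have : (128 : ℝ) ^ 5 ≤ A ^ 5 := by gcongr
    linarith
  nlinarith

theorem drift_le (h : Scales P A s θ N) : N * (P.β * (s ^ 2) ^ 2) ≤ s ^ 2 / 64 := by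
  have hA := h.hA
  have hs := h.s_pos
  calc N * (P.β * (s ^ 2) ^ 2) = (N * s) * P.β * s ^ 3 := by ring
    _ ≤ (2 * A ^ 2) * A * s ^ 3 := by
      have := mul_le_mul h.N_le h.β_le h.hβ.le (by positivity)
      gcongr
    _ = 2 * (s * A ^ 3) * s ^ 2 := by ring
    _ ≤ 2 * (1 / 128) * s ^ 2 := by
      gcongr
      exact h.small_of_le (by norm_num)
    _ = s ^ 2 / 64 := by ring

theorem travel_le (h : Scales P A s θ N) {d : ℕ} {v : Vec d} (hv : IsMild A s θ v) :
    N * s ^ 2 + θ * ‖v‖ ≤ 3 * A ^ 2 * s := by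
  have hA := h.hA
  have hs := h.s_pos
  have h1 := h.mild_le hv
  have h2 := mul_le_mul_of_nonneg_right h.N_le hs.le
  have h3 : 1 * s ≤ A ^ 2 * s := by
    gcongr
    exact one_le_pow₀ (by linarith)
  nlinarith

theorem half_le (h : Scales P A s θ N) : A ^ 2 / 2 ≤ ((N - 1 : ℕ) : ℝ) * s := by
  have h1 := h.le_N
  have hN := h.four_le_N
  have h2 : (N : ℝ) ≤ 2 * ((N - 1 : ℕ) : ℝ) := by exact_mod_cast (by omega : N ≤ 2 * (N - 1))
  have := mul_le_mul_of_nonneg_right h2 h.s_pos.le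
  linarith

end Scales

section Block

variable {P : Params} {A s θ : ℝ} {N d : ℕ} {f : Vec d → ℝ}

/-- Telescopes the one-step descent from iterate `1`, since the step out of iterate `0` carries the
noise and is estimated separately. -/
theorem IsSmooth.iterate_le {β η : ℝ} (hβ : 0 ≤ β) (hη : 0 ≤ η) (hf : IsSmooth β f)
    (x v : Vec d) (n : ℕ) (hn : n + 1 ≤ N) :
    f (iterate f η θ N x (fun _ => v) (n + 1)) ≤ f (iterate f η θ N x (fun _ => v) 1)
      - η * ∑ i ∈ Finset.range n, ‖gradient f (iterate f η θ N x (fun _ => v) (i + 1))‖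
      + n * (β * η ^ 2) := by
  induction n with
  | zero => simp
  | succ n ih =>
    have h1 := ih (by omega)
    have h2 := hf.step_le hβ hη (iterate f η θ N x (fun _ => v) (n + 1))
    rw [← iterate_succ_of_pos f η θ N x v (n + 1) (by omega) (by omega)] at h2
    rw [Finset.sum_range_succ]
    push_cast
    linarith

theorem IsSmooth.iterate_one_le {β η : ℝ} (hβ : 0 ≤ β) (hη : 0 ≤ η) (hθ : 0 ≤ θ)
    (hf : IsSmooth β f) (x v : Vec d) :
    f (iterate f η θ N x (fun _ => v) 1) ≤
      f x + ‖gradient f x‖ * (θ * ‖v‖) + β * (η + θ * ‖v‖) ^ 2 := by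
  rw [iterate_one]
  have h1 := (abs_le.1 (hf.abs_sub_sub_inner_le hβ x
    (x - η • normalizedGradient f x + θ • v))).2
  have e : x - η • normalizedGradient f x + θ • v - x
      = -(η • normalizedGradient f x) + θ • v := by abel
  rw [e, inner_add_right, inner_neg_right, inner_smul_right,
    inner_gradient_normalizedGradient] at h1
  have h2 : ‖-(η • normalizedGradient f x) + θ • v‖ ≤ η + θ * ‖v‖ := by
    refine (norm_add_le _ _).trans ?_
    rw [norm_neg, norm_smul, norm_smul, Real.norm_of_nonneg hη, Real.norm_of_nonneg hθ]
    gcongr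
    exact mul_le_of_le_one_right hη (norm_normalizedGradient_le f x)
  have h3 : β * ‖-(η • normalizedGradient f x) + θ • v‖ ^ 2 ≤ β * (η + θ * ‖v‖) ^ 2 := by gcongr
  have h4 : inner ℝ (gradient f x) (θ • v) ≤ ‖gradient f x‖ * (θ * ‖v‖) := by
    refine (real_inner_le_norm _ _).trans ?_
    rw [norm_smul, Real.norm_of_nonneg hθ]
  have h5 : 0 ≤ η * ‖gradient f x‖ := by positivity
  linarith

theorem Scales.block_le (h : Scales P A s θ N) (hf : IsSmooth P.β f) (x v : Vec d)
    (hv : IsMild A s θ v) :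
    f (block f (s ^ 2) θ N x v) ≤ f x + ‖gradient f x‖ * (θ * ‖v‖)
      - s ^ 2 * ∑ i ∈ Finset.range (N - 1),
        ‖gradient f (iterate f (s ^ 2) θ N x (fun _ => v) (i + 1))‖ + s ^ 2 / 32 := by
  have hN := h.four_le_N
  have h1 := hf.iterate_le (θ := θ) h.hβ.le (sq_nonneg s) x v (N - 1) (by omega : N - 1 + 1 ≤ N)
  have h2 := hf.iterate_one_le (N := N) h.hβ.le (sq_nonneg s) h.θ_nonneg x v
  have h3 := h.mild_sq hv
  have h4 := h.drift_le
  rw [Nat.sub_add_cancel (by omega)] at h1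
  have h5 : P.β * (s ^ 2 + θ * ‖v‖) ^ 2 ≤ A * (s ^ 2 + θ * ‖v‖) ^ 2 := by
    gcongr
    exact h.β_le
  have h6 : ((N - 1 : ℕ) : ℝ) * (P.β * (s ^ 2) ^ 2) ≤ N * (P.β * (s ^ 2) ^ 2) := by
    have := h.hβ
    gcongr
    exact Nat.sub_le N 1
  rw [block]
  linarith

/-- The threshold `A ^ 4 * s` separating large from small gradients exceeds this variation by a
factor `A / 3`, so the two cases are stable along a block. -/
theorem Scales.norm_gradient_iterate_sub_le (h : Scales P A s θ N) (hf : IsSmooth P.β f)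
    (x v : Vec d) (hv : IsMild A s θ v) (t : ℕ) (ht : t ≤ N) :
    ‖gradient f (iterate f (s ^ 2) θ N x (fun _ => v) t) - gradient f x‖ ≤ 3 * A ^ 3 * s := by
  have h1 := norm_iterate_sub_le f (sq_nonneg s) h.θ_nonneg N x v t ht
  have h2 := h.travel_le hv
  have h3 : (t : ℝ) * s ^ 2 ≤ N * s ^ 2 := by gcongr
  have hA := h.hA
  calc _ ≤ P.β * ‖iterate f (s ^ 2) θ N x (fun _ => v) t - x‖ := hf.2 _ _
    _ ≤ A * (3 * A ^ 2 * s) := by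
      gcongr
      · exact h.β_le
      · linarith
    _ = 3 * A ^ 3 * s := by ring

theorem Scales.mild_noise_le (h : Scales P A s θ N) {v : Vec d} (hv : IsMild A s θ v) :
    A ^ 4 * (θ * ‖v‖) ≤ s / 128 := by
  have hA := h.hA
  rw [IsMild] at hv
  have h1 : 0 ≤ s ^ 2 * A ^ 5 := by positivity
  have h2 : 0 ≤ A ^ 4 * (θ * ‖v‖) := by have := h.θ_nonneg; positivity
  have h3 : (s ^ 2 + θ * ‖v‖) * A ^ 5 = s ^ 2 * A ^ 5 + A * (A ^ 4 * (θ * ‖v‖)) := by ring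
  nlinarith

/-- A block starting at a point with a large gradient decreases the function. -/
theorem Scales.block_le_of_large_gradient (h : Scales P A s θ N) (hf : IsSmooth P.β f)
    (x v : Vec d) (hv : IsMild A s θ v) (hx : A ^ 4 * s ≤ ‖gradient f x‖) :
    f (block f (s ^ 2) θ N x v) ≤ f x - s ^ 2 := by
  have h1 := h.block_le hf x v hv
  have hA := h.hA
  have hs := h.s_pos
  have hA3 : 0 < A ^ 3 := by positivity
  have hlow : ∀ i ∈ Finset.range (N - 1), ‖gradient f x‖ / 2 ≤
      ‖gradient f (iterate f (s ^ 2) θ N x (fun _ => v) (i + 1))‖ := by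
    intro i hi
    have hi' := Finset.mem_range.1 hi
    have h2 := h.norm_gradient_iterate_sub_le hf x v hv (i + 1) (by omega)
    have h3 := norm_sub_norm_le (gradient f x)
      (gradient f (iterate f (s ^ 2) θ N x (fun _ => v) (i + 1)))
    rw [norm_sub_rev] at h3
    have h4 : 6 * (A ^ 3 * s) ≤ A * (A ^ 3 * s) := by gcongr; linarith
    have h5 : A ^ 4 * s = A * (A ^ 3 * s) := by ring
    linarith
  have h2 := Finset.card_nsmul_le_sum _ _ _ hlow
  rw [Finset.card_range, nsmul_eq_mul] at h2
  have h3 := h.half_le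
  have h4 : θ * ‖v‖ ≤ s / 128 := by
    have h5 := h.mild_noise_le hv
    have h6 : 0 ≤ θ * ‖v‖ := by have := h.θ_nonneg; positivity
    have h7 : 1 ≤ A ^ 4 := one_le_pow₀ (by linarith)
    nlinarith
  set G := ‖gradient f x‖
  have hG : 0 ≤ G := norm_nonneg _
  have h5 : G * (θ * ‖v‖) ≤ G * (s / 128) := by gcongr
  have h6 : s ^ 2 * (((N - 1 : ℕ) : ℝ) * (G / 2)) ≤ s ^ 2 * ∑ i ∈ Finset.range (N - 1),
        ‖gradient f (iterate f (s ^ 2) θ N x (fun _ => v) (i + 1))‖ := by gcongr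
  have h7 : A ^ 2 / 2 * (s * G / 2) ≤ ((N - 1 : ℕ) : ℝ) * s * (s * G / 2) := by gcongr
  have h8 : 128 * (s * G) ≤ A ^ 2 * (s * G) := by
    gcongr
    nlinarith
  have h9 : s * (A ^ 4 * s) ≤ s * G := by gcongr
  have h10 : 1 * s ^ 2 ≤ A ^ 4 * s ^ 2 := by
    gcongr
    exact one_le_pow₀ (by linarith)
  nlinarith

/-- A block starting at a point with a small gradient hardly increases the function. -/
theorem Scales.block_le_of_small_gradient (h : Scales P A s θ N) (hf : IsSmooth P.β f)
    (x v : Vec d) (hv : IsMild A s θ v) (hx : ‖gradient f x‖ ≤ A ^ 4 * s) :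
    f (block f (s ^ 2) θ N x v) + s ^ 2 * ∑ i ∈ Finset.range (N - 1),
        ‖gradient f (iterate f (s ^ 2) θ N x (fun _ => v) (i + 1))‖ ≤ f x + s ^ 2 / 16 := by
  have h1 := h.block_le hf x v hv
  have hs := h.s_pos
  have h2 : ‖gradient f x‖ * (θ * ‖v‖) ≤ A ^ 4 * s * (θ * ‖v‖) := by
    have := h.θ_nonneg
    gcongr
  have h3 := mul_le_mul_of_nonneg_left (h.mild_noise_le hv) hs.le
  nlinarith

end Block

/-- Discrete Grönwall: after division by the running product, which is at least `1`, each step loses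
at most `E`. -/
theorem le_of_forall_mul_sub_le {a b : ℕ → ℝ} {E : ℝ} (hE : 0 ≤ E) (n : ℕ)
    (ha : ∀ i < n, 0 ≤ a i) (hb : ∀ i < n, (1 + a i) * b i - E ≤ b (i + 1)) :
    (∏ i ∈ Finset.range n, (1 + a i)) * (b 0 - n * E) ≤ b n := by
  induction n with
  | zero => simp
  | succ n ih =>
    have h1 := ih (fun i hi => ha i (by omega)) (fun i hi => hb i (by omega))
    have h2 := hb n (by omega)
    have h3 := ha n (by omega)
    have h4 : 1 ≤ ∏ i ∈ Finset.range (n + 1), (1 + a i) := by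
      refine Finset.one_le_prod fun i hi => ?_
      have := ha i (Finset.mem_range.1 hi)
      linarith
    rw [Finset.prod_range_succ] at h4 ⊢
    have h5 := mul_le_mul_of_nonneg_left h1 (by linarith : 0 ≤ 1 + a n)
    have h6 := mul_le_mul_of_nonneg_right h4 hE
    push_cast
    nlinarith

/-- A sequence whose relative growth is at least `c / g i`, where `g` is small on average, grows
exponentially. -/
theorem mul_exp_le_of_growth {b g : ℕ → ℝ} {E δ c S : ℝ} (n : ℕ) (hE : 0 ≤ E) (hδ : 0 < δ)
    (hc : 0 < c) (hbg : ∀ i < n, b i ≤ g i) (hg : ∀ i < n, 0 ≤ g i)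
    (hb : ∀ i < n, (1 + c * (g i)⁻¹) * b i - E ≤ b (i + 1))
    (hS : ∑ i ∈ Finset.range n, g i ≤ S) (h0 : δ + n * E ≤ b 0) (hn : 0 < n) :
    δ * Real.exp (c * n ^ 2 / (S + n * c)) ≤ b n := by
  have hpos : ∀ i ≤ n, 1 ≤ ∏ j ∈ Finset.range i, (1 + c * (g j)⁻¹) := by
    intro i hi
    refine Finset.one_le_prod fun j hj => ?_
    have := hg j (by have := Finset.mem_range.1 hj; omega)
    have : 0 ≤ c * (g j)⁻¹ := by positivity
    linarith
  have hlow : ∀ i ≤ n, (∏ j ∈ Finset.range i, (1 + c * (g j)⁻¹)) * δ ≤ b i := by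
    intro i hi
    refine le_trans ?_ (le_of_forall_mul_sub_le hE i (fun j hj => ?_) (fun j hj => hb j (by omega)))
    · have := hpos i hi
      have h2 : (i : ℝ) * E ≤ n * E := by gcongr
      gcongr
      linarith
    · have := hg j (by omega)
      positivity
  -- The lower bound `δ` on `b i` passes to `g i`, so the inverses are genuine from here on.
  have hgpos : ∀ i < n, 0 < g i := by
    intro i hi
    have h1 := hlow i hi.le
    have h2 := hpos i hi.le
    have h3 := hbg i hi
    nlinarith
  refine le_trans ?_ (hlow n le_rfl)
  rw [mul_comm]
  refine mul_le_mul_of_nonneg_right ?_ hδ.le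
  -- This is `log x ≥ 1 - 1/x` at `x = 1 + c / g i`; unlike a linear bound on the logarithm, it
  -- stays valid when `g i` is much smaller than `c`.
  have hstep : ∀ i ∈ Finset.range n, Real.exp (c / (g i + c)) ≤ 1 + c * (g i)⁻¹ := by
    intro i hi
    have hgi := hgpos i (Finset.mem_range.1 hi)
    have hp : 0 < 1 + c * (g i)⁻¹ := by positivity
    rw [← Real.le_log_iff_exp_le hp]
    refine le_trans (le_of_eq ?_) (Real.one_sub_inv_le_log_of_pos hp)
    field_simp
    ring
  refine le_trans ?_ (Finset.prod_le_prod (fun i _ => (Real.exp_pos _).le) hstep)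
  rw [← Real.exp_sum]
  apply Real.exp_le_exp.2
  -- Cauchy–Schwarz in Sedrakyan's form: a small sum of the `g i + c` forces a large sum of their
  -- inverses.
  have hti := Finset.sq_sum_div_le_sum_sq_div (Finset.range n) (fun _ => (1 : ℝ))
    (g := fun i => g i + c) (fun i hi => by
      have := hgpos i (Finset.mem_range.1 hi)
      positivity)
  have hsum : 0 < ∑ i ∈ Finset.range n, (g i + c) := by
    refine Finset.sum_pos (fun i hi => ?_) ⟨0, Finset.mem_range.2 hn⟩
    have := hgpos i (Finset.mem_range.1 hi)
    positivity
  have hsum' : ∑ i ∈ Finset.range n, (g i + c) ≤ S + n * c := by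
    rw [Finset.sum_add_distrib]
    simpa using hS
  calc c * n ^ 2 / (S + n * c) ≤ c * n ^ 2 / ∑ i ∈ Finset.range n, (g i + c) := by gcongr
    _ = c * ((∑ i ∈ Finset.range n, (1 : ℝ)) ^ 2 / ∑ i ∈ Finset.range n, (g i + c)) := by
      simp [mul_div_assoc]
    _ ≤ c * ∑ i ∈ Finset.range n, (1 : ℝ) ^ 2 / (g i + c) := by gcongr
    _ = ∑ i ∈ Finset.range n, c / (g i + c) := by
      rw [Finset.mul_sum]
      simp [div_eq_mul_inv]

end SaddleNGD

/-! ### Escape from saddle points and attraction to minima. -/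

namespace SaddleNGD

variable {P : Params} {A s θ : ℝ} {N d : ℕ} {f : Vec d → ℝ}

/-- At a saddle point with a small gradient, the noise vectors whose block fails to decrease the
function lie in a thin slab orthogonal to the direction of negative curvature. -/
theorem Scales.mem_slab_of_not_decrease (h : Scales P A s θ N) (hf : IsSmooth P.β f)
    (hH : HasLipschitzHessian P.ρ f) (x v u : Vec d) (hv : IsMild A s θ v)
    (hx : ‖gradient f x‖ ≤ A ^ 4 * s) {l : ℝ} (hl : l ≤ -P.γ) (hu : ‖u‖ = 1)
    (hul : hessian f x u = l • u) (hdec : f x - s ^ 2 < f (block f (s ^ 2) θ N x v)) :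
    |inner ℝ u (gradient f x) - l * s ^ 2 * inner ℝ u (normalizedGradient f x) +
      l * θ * inner ℝ u v| < |l| * θ / 32 := by
  by_contra! hslab
  have hA := h.hA
  have hs := h.s_pos
  have hN := h.four_le_N
  have hθ := h.θ_nonneg
  have hρ := h.hρ
  have hγ : 0 < P.γ := by
    by_contra! hγ
    have := h.γ_inv
    nlinarith
  have hsmall := h.block_le_of_small_gradient hf x v hv hx
  have hinner : ∀ y, inner ℝ u (hessian f x y) = l * inner ℝ u y := by
    intro y
    rw [inner_hessian_comm hH.1, hul, real_inner_smul_left]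
  set X : ℕ → Vec d := fun t => iterate f (s ^ 2) θ N x (fun _ => v) t with hX
  set E : ℝ := 3 * A ^ 3 * s ^ 3 with hE
  have hdist : ∀ t ≤ N, ‖X t - x‖ ≤ 3 * A ^ 2 * s := by
    intro t ht
    have h1 := norm_iterate_sub_le f (sq_nonneg s) hθ N x v t ht
    have h2 := h.travel_le hv
    have h3 : (t : ℝ) * s ^ 2 ≤ N * s ^ 2 := by gcongr
    exact h1.trans (by linarith)
  have htaylor : ∀ y z : Vec d, ∀ R, ‖y - x‖ ≤ R → ‖z - x‖ ≤ R →
      |inner ℝ u (gradient f z) - inner ℝ u (gradient f y) - l * inner ℝ u (z - y)| ≤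
        A * R * ‖z - y‖ := by
    intro y z R hy hz
    have h1 := hH.norm_gradient_sub_sub_le hρ.le x y z R hy hz
    have h2 := abs_real_inner_le_norm u (gradient f z - gradient f y - hessian f x (z - y))
    rw [hu, one_mul, inner_sub_right, inner_sub_right, hinner] at h2
    refine h2.trans (h1.trans ?_)
    have : 0 ≤ R := (norm_nonneg _).trans hy
    gcongr
    exact h.ρ_le
  -- The quantity in `hslab` is the linear prediction of `⟨u, ∇f(X 1)⟩`. Outside the slab it is at
  -- least `|l| θ / 32 ≥ 4 A⁶ s²`, because `θ = A⁸ s²` and `|l| ≥ γ ≥ 1/A`; the Taylor error is at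
  -- most `s² / 64`.
  have hfirst : 2 * (A ^ 6 * s ^ 2) ≤ |inner ℝ u (gradient f (X 1))| := by
    have h1 := htaylor x (X 1) (s ^ 2 + θ * ‖v‖) (by simp; positivity) (by
      have := norm_iterate_sub_le f (sq_nonneg s) hθ N x v 1 (by omega)
      simpa using this)
    have h2 : ‖X 1 - x‖ ≤ s ^ 2 + θ * ‖v‖ := by
      have := norm_iterate_sub_le f (sq_nonneg s) hθ N x v 1 (by omega)
      simpa using this
    have h3 : A * (s ^ 2 + θ * ‖v‖) * ‖X 1 - x‖ ≤ A * (s ^ 2 + θ * ‖v‖) ^ 2 := by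
      rw [pow_two (s ^ 2 + _), ← mul_assoc]
      gcongr
    have h4 := h.mild_sq hv
    have h5 : X 1 - x = -(s ^ 2 • normalizedGradient f x) + θ • v := by
      simp only [hX, iterate_one]
      abel
    rw [h5, inner_add_right, inner_neg_right, inner_smul_right, inner_smul_right, ← h5] at h1
    have h6 : 4 * (A ^ 6 * s ^ 2) ≤ |l| * θ / 32 := by
      have h7 : P.γ ≤ |l| := by rw [abs_of_nonpos (by linarith)]; linarith
      have h8 : A ^ 7 * s ^ 2 ≤ |l| * θ := by
        rw [h.hθ]
        calc A ^ 7 * s ^ 2 = 1 * (A ^ 7 * s ^ 2) := by ring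
          _ ≤ (A * P.γ) * (A ^ 7 * s ^ 2) := by
            gcongr
            exact h.γ_inv
          _ = P.γ * (A ^ 8 * s ^ 2) := by ring
          _ ≤ |l| * (A ^ 8 * s ^ 2) := by gcongr
      have h9 : 128 * (A ^ 6 * s ^ 2) ≤ A * (A ^ 6 * s ^ 2) := by gcongr
      have h10 : A * (A ^ 6 * s ^ 2) = A ^ 7 * s ^ 2 := by ring
      linarith
    have h11 : 1 * s ^ 2 ≤ A ^ 6 * s ^ 2 := by
      gcongr
      exact one_le_pow₀ (by linarith)
    have h12 := abs_sub_abs_le_abs_sub (inner ℝ u (gradient f x) -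
      l * s ^ 2 * inner ℝ u (normalizedGradient f x) + l * θ * inner ℝ u v)
      (inner ℝ u (gradient f (X 1)))
    rw [abs_sub_comm] at h12
    have h13 : inner ℝ u (gradient f (X 1)) - (inner ℝ u (gradient f x) -
      l * s ^ 2 * inner ℝ u (normalizedGradient f x) + l * θ * inner ℝ u v) =
      inner ℝ u (gradient f (X 1)) - inner ℝ u (gradient f x) -
        l * (-(s ^ 2 * inner ℝ u (normalizedGradient f x)) + θ * inner ℝ u v) := by ring
    rw [h13] at h12
    nlinarith
  -- Moving by `-s² ∇f/‖∇f‖` changes the `u`-component of the gradient by `-l s²/‖∇f‖` times itself,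
  -- and `-l ≥ γ`. The error `E` comes from the drift of the Hessian along the block.
  have hstep : ∀ i < N - 1, (1 + P.γ * s ^ 2 * ‖gradient f (X (i + 1))‖⁻¹) *
      |inner ℝ u (gradient f (X (i + 1)))| - E ≤ |inner ℝ u (gradient f (X (i + 1 + 1)))| := by
    intro i hi
    have h1 := htaylor (X (i + 1)) (X (i + 1 + 1)) (3 * A ^ 2 * s) (hdist _ (by omega))
      (hdist _ (by omega))
    have h2 : X (i + 1 + 1) - X (i + 1) = -(s ^ 2 • normalizedGradient f (X (i + 1))) := by
      simp only [hX]
      rw [iterate_succ_of_pos f (s ^ 2) θ N x v (i + 1) (by omega) (by omega)]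
      abel
    have h3 : ‖X (i + 1 + 1) - X (i + 1)‖ ≤ s ^ 2 := by
      rw [h2, norm_neg, norm_smul, Real.norm_of_nonneg (sq_nonneg s)]
      exact mul_le_of_le_one_right (sq_nonneg s) (norm_normalizedGradient_le f _)
    have h4 : A * (3 * A ^ 2 * s) * ‖X (i + 1 + 1) - X (i + 1)‖ ≤ E := by
      calc _ ≤ A * (3 * A ^ 2 * s) * s ^ 2 := by gcongr
        _ = E := by rw [hE]; ring
    have h5 := h1.trans h4
    rw [h2, normalizedGradient, inner_neg_right, inner_smul_right, inner_smul_right] at h5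
    set w := inner ℝ u (gradient f (X (i + 1)))
    set w' := inner ℝ u (gradient f (X (i + 1 + 1)))
    set q := s ^ 2 * ‖gradient f (X (i + 1))‖⁻¹ with hq
    have hq0 : 0 ≤ q := by positivity
    have h6 : w' - w - l * -(s ^ 2 * (‖gradient f (X (i + 1))‖⁻¹ * w)) =
      w' - (1 - l * q) * w := by rw [hq]; ring
    rw [h6, abs_sub_comm] at h5
    have h7 := abs_sub_abs_le_abs_sub ((1 - l * q) * w) w'
    have h9 : P.γ * q ≤ -l * q := by gcongr; linarith
    have h10 : 0 ≤ P.γ * q := by positivity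
    rw [abs_mul, abs_of_nonneg (by linarith : 0 ≤ 1 - l * q)] at h7
    have h8 : (1 + P.γ * q) * |w| ≤ (1 - l * q) * |w| := by
      gcongr
      linarith
    have h11 : (1 + P.γ * s ^ 2 * ‖gradient f (X (i + 1))‖⁻¹) = 1 + P.γ * q := by rw [hq]; ring
    rw [h11]
    linarith
  have hEN : ((N - 1 : ℕ) : ℝ) * E ≤ A ^ 6 * s ^ 2 := by
    calc ((N - 1 : ℕ) : ℝ) * E ≤ N * E := by
          gcongr
          exact Nat.sub_le N 1
      _ = (N * s) * (3 * A ^ 3 * s ^ 2) := by rw [hE]; ring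
      _ ≤ (2 * A ^ 2) * (3 * A ^ 3 * s ^ 2) := mul_le_mul_of_nonneg_right h.N_le (by positivity)
      _ = 6 * (A ^ 5 * s ^ 2) := by ring
      _ ≤ A * (A ^ 5 * s ^ 2) := by gcongr; linarith
      _ = A ^ 6 * s ^ 2 := by ring
  -- This is where the failure to decrease enters: `s²` times the sum is below `s² + s² / 16`.
  have hsum : ∑ i ∈ Finset.range (N - 1), ‖gradient f (X (i + 1))‖ ≤ 2 := by
    have h1 : s ^ 2 * ∑ i ∈ Finset.range (N - 1), ‖gradient f (X (i + 1))‖ ≤ s ^ 2 * 2 := by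
      have h2 : f (block f (s ^ 2) θ N x v) +
        s ^ 2 * ∑ i ∈ Finset.range (N - 1), ‖gradient f (X (i + 1))‖ ≤ f x + s ^ 2 / 16 := hsmall
      have := sq_nonneg s
      linarith
    exact le_of_mul_le_mul_left h1 (by positivity)
  have hgrow := mul_exp_le_of_growth (b := fun i => |inner ℝ u (gradient f (X (i + 1)))|)
    (g := fun i => ‖gradient f (X (i + 1))‖) (E := E) (δ := s ^ 2) (c := P.γ * s ^ 2) (S := 2)
    (N - 1) (by positivity) (by positivity) (by positivity)
    (fun i _ => by simpa [hu] using abs_real_inner_le_norm u (gradient f (X (i + 1))))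
    (fun i _ => norm_nonneg _) hstep hsum (by
      have h11 : 1 * s ^ 2 ≤ A ^ 6 * s ^ 2 := by
        gcongr
        exact one_le_pow₀ (by linarith)
      simp only [zero_add]
      linarith) (by omega)
  have hlast : |inner ℝ u (gradient f (X (N - 1 + 1)))| ≤ 1 := by
    have h1 := abs_real_inner_le_norm u (gradient f (X (N - 1 + 1)))
    rw [hu, one_mul] at h1
    have h2 := h.norm_gradient_iterate_sub_le hf x v hv (N - 1 + 1) (by omega)
    have h3 := norm_sub_norm_le (gradient f (X (N - 1 + 1))) (gradient f x)
    have h4 := h.small_of_le (m := 4) (by norm_num)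
    have h5 := h.small_of_le (m := 3) (by norm_num)
    have h6 := h2
    linarith
  -- The numerator is at least `γ (A² / 2)² ≥ A³ / 4` and the denominator at most `3`. The length `N
  -- ≈ A² / s` is what makes this exceed `3 A`.
  have hexp : 3 * A ≤ P.γ * s ^ 2 * ((N - 1 : ℕ) : ℝ) ^ 2 / (2 + ((N - 1 : ℕ) : ℝ) * (P.γ * s ^ 2)) := by
    have h0 := h.half_le
    set n : ℝ := ((N - 1 : ℕ) : ℝ)
    have hn : 0 ≤ n := Nat.cast_nonneg _
    have h1 : n * (P.γ * s ^ 2) ≤ 1 := by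
      have hn' : n * s ≤ 2 * A ^ 2 := by
        refine le_trans ?_ h.N_le
        gcongr
        exact Nat.cast_le.2 (Nat.sub_le N 1)
      have h5 := h.small_of_le (m := 3) (by norm_num)
      calc n * (P.γ * s ^ 2) = (n * s) * P.γ * s := by ring
        _ ≤ (2 * A ^ 2) * A * s := by
          have := mul_le_mul hn' h.γ_le hγ.le (by positivity)
          gcongr
        _ = 2 * (s * A ^ 3) := by ring
        _ ≤ 1 := by linarith
    rw [le_div_iff₀ (by positivity)]
    have h2 : A ^ 4 / 4 ≤ (n * s) ^ 2 := by
      calc A ^ 4 / 4 = (A ^ 2 / 2) ^ 2 := by ring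
        _ ≤ (n * s) ^ 2 := by gcongr
    have h3 : A ^ 3 / 4 ≤ P.γ * (n * s) ^ 2 := by
      calc A ^ 3 / 4 = 1 * (A ^ 3 / 4) := by ring
        _ ≤ (A * P.γ) * (A ^ 3 / 4) := by
          gcongr
          exact h.γ_inv
        _ = P.γ * (A ^ 4 / 4) := by ring
        _ ≤ P.γ * (n * s) ^ 2 := by gcongr
    have h4 : (128 : ℝ) ^ 2 * A ≤ A ^ 2 * A := by gcongr
    nlinarith
  -- Two of the three factors `e^A` cancel `s ^ 2`, since `e^{-A} ≤ s`; the third gives strictness.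
  have hexp' : 1 < s ^ 2 * Real.exp (P.γ * s ^ 2 * ((N - 1 : ℕ) : ℝ) ^ 2 /
      (2 + ((N - 1 : ℕ) : ℝ) * (P.γ * s ^ 2))) := by
    calc 1 < Real.exp A := Real.one_lt_exp_iff.2 (by linarith)
      _ = Real.exp (-A) ^ 2 * Real.exp (3 * A) := by
        rw [← Real.exp_nat_mul, ← Real.exp_add]
        congr 1
        push_cast
        ring
      _ ≤ _ := by
        have := h.exp_le
        gcongr
  exact absurd (hgrow.trans hlast) (not_le.2 hexp')

/-- Add the strong convexity inequalities for the two orderings of the pair: the function values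
cancel and the gradient at `xs` vanishes. -/
theorem IsStronglyConvexOn.mul_sq_le_inner {α r : ℝ} {xs x : Vec d} (hxs : gradient f xs = 0)
    (hc : IsStronglyConvexOn α f (Metric.closedBall xs r)) (hx : ‖x - xs‖ ≤ r) :
    α * ‖x - xs‖ ^ 2 ≤ inner ℝ (gradient f x) (x - xs) := by
  have hmem : x ∈ Metric.closedBall xs r := by simpa [dist_eq_norm] using hx
  have hmem' : xs ∈ Metric.closedBall xs r :=
    Metric.mem_closedBall_self ((norm_nonneg _).trans hx)
  have h1 := hc x hmem xs hmem'
  have h2 := hc xs hmem' x hmem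
  rw [hxs, inner_zero_left, norm_sub_rev] at h2
  have : inner ℝ (gradient f x) (xs - x) = -inner ℝ (gradient f x) (x - xs) := by
    rw [← inner_neg_right, neg_sub]
  linarith

/-- A step of normalized gradient descent in a strongly convex region approaches the minimum. -/
theorem norm_step_sub_le {β α η q r : ℝ} (hη : 0 ≤ η) (hα : 0 < α) (hq : 0 < q) (hq1 : q ≤ 1)
    (hqα : q * β ≤ α) (hf : IsSmooth β f) {xs : Vec d}
    (hxs : gradient f xs = 0)
    (hc : IsStronglyConvexOn α f (Metric.closedBall xs r)) {x : Vec d} (hx : ‖x - xs‖ ≤ r) :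
    ‖x - η • normalizedGradient f x - xs‖ ≤ max (‖x - xs‖ - η * q / 2) (2 * η / q) := by
  have h3 := hc.mul_sq_le_inner hxs hx
  set z := ‖x - xs‖ with hz
  have hz0 : 0 ≤ z := norm_nonneg _
  have h4 : ‖gradient f x‖ ≤ β * z := by simpa [hxs] using hf.2 x xs
  -- The gradient makes an angle of cosine at least `q ≤ α / β` with `x - xs`. At a critical point
  -- strong convexity forces `x = xs`, so the value `0` of the normalized gradient does no harm.
  have h5 : q * z ≤ inner ℝ (normalizedGradient f x) (x - xs) := by
    rw [normalizedGradient, real_inner_smul_left]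
    rcases (norm_nonneg (gradient f x)).eq_or_lt with h0 | h0
    · have : gradient f x = 0 := norm_eq_zero.1 h0.symm
      rw [this, inner_zero_left] at h3
      have hz' : z = 0 := by
        have : z ^ 2 ≤ 0 := by nlinarith
        exact pow_eq_zero_iff (two_ne_zero) |>.1 (le_antisymm this (sq_nonneg _))
      rw [← h0, hz']
      simp
    · rw [inv_mul_eq_div, le_div_iff₀ h0]
      calc q * z * ‖gradient f x‖ ≤ q * z * (β * z) := by gcongr
        _ = (q * β) * z ^ 2 := by ring
        _ ≤ α * z ^ 2 := by gcongr
        _ ≤ _ := h3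
  have h6 : ‖η • normalizedGradient f x‖ ≤ η := by
    rw [norm_smul, Real.norm_of_nonneg hη]
    exact mul_le_of_le_one_right hη (norm_normalizedGradient_le f x)
  have e : x - η • normalizedGradient f x - xs = (x - xs) - η • normalizedGradient f x := by abel
  rw [e]
  -- Far away, the squared distance is at most `z² - 2ηqz + η² ≤ z² - ηqz ≤ (z - ηq/2)²`. Close by,
  -- the step may overshoot, but `z + η ≤ 2η/q`.
  by_cases hcase : η ≤ q * z
  · refine le_max_of_le_left ?_
    have hq' : η * q / 2 ≤ z := by nlinarith
    refine abs_le_of_sq_le_sq' ?_ (by linarith) |>.2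
    rw [norm_sub_sq_real, inner_smul_right, real_inner_comm, ← hz]
    have h7 : ‖η • normalizedGradient f x‖ ^ 2 ≤ η ^ 2 := by gcongr
    have h8 : η * (q * z) ≤ η * inner ℝ (normalizedGradient f x) (x - xs) := by gcongr
    nlinarith [sq_nonneg (η * q)]
  · refine le_max_of_le_right ((norm_sub_le _ _).trans ?_)
    rw [← hz, le_div_iff₀ hq]
    nlinarith

/-- A block starting close to a strongly convex local minimum ends close to it. -/
theorem Scales.norm_block_sub_le (h : Scales P A s θ N) (hf : IsSmooth P.β f) (x v xs : Vec d)
    (hv : IsMild A s θ v) (hxs : gradient f xs = 0)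
    (hc : IsStronglyConvexOn P.α f (Metric.closedBall xs (2 * P.r)))
    (hx : ‖x - xs‖ ≤ A ^ 5 * s) : ‖block f (s ^ 2) θ N x v - xs‖ ≤ A ^ 5 * s := by
  have hA := h.hA
  have hs := h.s_pos
  have hN := h.four_le_N
  have hβ := h.hβ
  have hα : 0 < P.α := by
    by_contra! hα
    have := h.α_inv
    nlinarith
  have hr : A ^ 6 * s ≤ 2 * P.r := by
    have h1 := h.small_of_le (m := 7) (by norm_num)
    have h2 := h.r_inv
    have h3 : A * (A ^ 6 * s) ≤ A * P.r := by
      have : A * (A ^ 6 * s) = s * A ^ 7 := by ring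
      linarith
    have h4 : A ^ 6 * s ≤ P.r := le_of_mul_le_mul_left h3 (by linarith)
    have : 0 ≤ A ^ 6 * s := by positivity
    linarith
  have hκ := h.mild_le hv
  have hθ := h.θ_nonneg
  have hA5 : 1 ≤ A ^ 5 := one_le_pow₀ (by linarith)
  have hs5 : 1 * s ≤ A ^ 5 * s := by gcongr
  have hA6 : 128 * (A ^ 5 * s) ≤ A * (A ^ 5 * s) := by gcongr
  have e6 : A * (A ^ 5 * s) = A ^ 6 * s := by ring
  have hs1 := h.small_of_le (m := 0) (by norm_num)
  rw [pow_zero, mul_one] at hs1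
  have h2η : 2 * s ^ 2 / (A ^ 2)⁻¹ ≤ A ^ 5 * s := by
    rw [div_inv_eq_mul]
    have h3 : A ^ 2 * s ≤ A ^ 5 * s := by
      gcongr
      · linarith
      · norm_num
    nlinarith
  have hq : (A ^ 2)⁻¹ * P.β ≤ P.α := by
    rw [inv_mul_le_iff₀ (by positivity)]
    have := h.α_inv
    have := h.β_le
    nlinarith
  -- Here `q = A⁻²`. The noisy step adds at most `s / 8`; each later step recovers `s² q / 2`, or
  -- the iterate is already within the overshoot radius.
  have key : ∀ i, i + 1 ≤ N → ‖iterate f (s ^ 2) θ N x (fun _ => v) (i + 1) - xs‖ ≤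
      max (A ^ 5 * s + s / 8 - i * (s ^ 2 * (A ^ 2)⁻¹ / 2)) (2 * s ^ 2 / (A ^ 2)⁻¹) := by
    intro i
    induction i with
    | zero =>
      intro _
      refine le_max_of_le_left ?_
      have h1 := norm_iterate_sub_le f (sq_nonneg s) hθ N x v 1 (by omega)
      have h2 := norm_sub_le_norm_sub_add_norm_sub
        (iterate f (s ^ 2) θ N x (fun _ => v) (0 + 1)) x xs
      simp only [zero_add, Nat.cast_one, one_mul, Nat.cast_zero, zero_mul] at h1 h2 ⊢
      linarith
    | succ i ih =>
      intro hi
      have h1 := ih (by omega)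
      have h3 : 0 ≤ s ^ 2 * (A ^ 2)⁻¹ / 2 := by positivity
      have h4 : 0 ≤ i * (s ^ 2 * (A ^ 2)⁻¹ / 2) := by positivity
      have h2 : ‖iterate f (s ^ 2) θ N x (fun _ => v) (i + 1) - xs‖ ≤ 2 * P.r := by
        refine h1.trans (max_le ?_ ?_) <;> linarith
      have h5 := norm_step_sub_le (sq_nonneg s) hα (by positivity : 0 < (A ^ 2)⁻¹)
        (inv_le_one_of_one_le₀ (one_le_pow₀ (by linarith))) hq
        hf hxs hc h2
      rw [← iterate_succ_of_pos f (s ^ 2) θ N x v (i + 1) (by omega) (by omega)] at h5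
      refine h5.trans (max_le ?_ (le_max_right _ _))
      push_cast
      rcases le_max_iff.1 h1 with h6 | h6
      · refine le_max_of_le_left ?_
        linarith
      · refine le_max_of_le_right ?_
        linarith
  have hlast := key (N - 1) (by omega)
  rw [Nat.sub_add_cancel (by omega)] at hlast
  rw [block]
  refine hlast.trans (max_le ?_ h2η)
  -- The `N - 1` noiseless steps recover twice the `s / 8` lost to the noise.
  have h7 : s / 4 ≤ ((N - 1 : ℕ) : ℝ) * (s ^ 2 * (A ^ 2)⁻¹ / 2) := by
    have h8 := mul_le_mul_of_nonneg_right h.half_le (by positivity : 0 ≤ s * (A ^ 2)⁻¹ / 2)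
    have h9 : A ^ 2 / 2 * (s * (A ^ 2)⁻¹ / 2) = s / 4 := by
      have : A ≠ 0 := by linarith
      field_simp
      norm_num
    linarith
  linarith

end SaddleNGD

/-! ### Gaussian estimates. -/

namespace SaddleNGD

open scoped ENNReal

section Gaussian

variable {d : ℕ}

theorem map_inner_stdGaussian {u : Vec d} (hu : ‖u‖ = 1) :
    (stdGaussian (Vec d)).map (fun v => inner ℝ u v) = gaussianReal 0 1 := by
  have h := IsGaussian.map_eq_gaussianReal (μ := stdGaussian (Vec d)) (innerSL ℝ u)
  rw [integral_strongDual_stdGaussian, variance_dual_stdGaussian, innerSL_apply_norm, hu] at h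
  simpa using h

theorem gaussianReal_le_volume (s : Set ℝ) : gaussianReal 0 1 s ≤ volume s := by
  rw [gaussianReal_of_var_ne_zero 0 one_ne_zero]
  calc (volume.withDensity (gaussianPDF 0 1)) s ≤ (volume.withDensity 1) s := by
        refine withDensity_mono (Filter.Eventually.of_forall fun x => ?_) s
        rw [gaussianPDF, Pi.one_apply, ENNReal.ofReal_le_one, gaussianPDFReal]
        have h1 : 1 ≤ √(2 * Real.pi * (1 : NNReal)) := by
          rw [Real.one_le_sqrt, NNReal.coe_one]
          linarith [Real.pi_gt_three]
        refine mul_le_one₀ (inv_le_one_of_one_le₀ h1) (Real.exp_pos _).le (Real.exp_le_one_iff.2 ?_)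
        rw [neg_div, Left.neg_nonpos_iff]
        positivity
    _ = volume s := by rw [withDensity_one]

/-- The slab confines a standard normal variable to an interval of length `1/16`, and the normal
density is at most `1`. -/
theorem stdGaussian_slab_le {u : Vec d} (hu : ‖u‖ = 1) {a : ℝ} (ha : a ≠ 0) (c : ℝ) :
    stdGaussian (Vec d) {v | |c + a * inner ℝ u v| < |a| / 32} ≤ 16⁻¹ := by
  have hsub : {v : Vec d | |c + a * inner ℝ u v| < |a| / 32} ⊆
      (fun v => inner ℝ u v) ⁻¹' (Metric.ball (-c / a) (1 / 32)) := by
    intro v hv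
    simp only [Set.mem_ofPred_eq] at hv
    rw [Set.mem_preimage, Metric.mem_ball, Real.dist_eq]
    have e : c + a * inner ℝ u v = a * (inner ℝ u v - -c / a) := by field_simp; ring
    rw [e, abs_mul] at hv
    have := abs_pos.2 ha
    by_contra! hcon
    nlinarith
  refine (measure_mono hsub).trans ?_
  rw [← Measure.map_apply (by fun_prop) Metric.isOpen_ball.measurableSet,
    map_inner_stdGaussian hu]
  refine (gaussianReal_le_volume _).trans ?_
  rw [Real.volume_ball, ← ENNReal.ofReal_ofNat, ← ENNReal.ofReal_inv_of_pos (by norm_num)]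
  exact ENNReal.ofReal_le_ofReal (by norm_num)

theorem stdGaussian_inner_ge_le {u : Vec d} (hu : ‖u‖ = 1) (t : ℝ) :
    (stdGaussian (Vec d)).real {v | t ≤ inner ℝ u v} ≤ Real.exp (1 / 2 - t) := by
  have hm : mgf (fun v => inner ℝ u v) (stdGaussian (Vec d)) 1 = Real.exp (1 / 2) := by
    rw [mgf_gaussianReal (map_inner_stdGaussian hu)]
    norm_num
  have h := measure_ge_le_exp_mul_mgf (μ := stdGaussian (Vec d)) (X := fun v => inner ℝ u v) (t := 1) t
    zero_le_one (by
      -- The moment generating function takes the value `0` without integrability, so its positivity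
      -- supplies the integrability required.
      rw [← mgf_pos_iff, hm]
      exact Real.exp_pos _)
  rw [hm, ← Real.exp_add] at h
  refine h.trans (Real.exp_le_exp.2 (by linarith))

/-- A union bound over the `2d` coordinate half-spaces, through the `ℓ¹` norm. The radius grows like
`d` rather than `√d`; the `d²` in the bound on `η` pays for this. -/
theorem stdGaussian_norm_gt_le (t : ℝ) :
    (stdGaussian (Vec d)).real {v | d * t < ‖v‖} ≤ 2 * d * Real.exp (1 / 2 - t) := by
  have hsub : {v : Vec d | d * t < ‖v‖} ⊆ ⋃ i ∈ (Finset.univ : Finset (Fin d)),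
      ({v | t ≤ inner ℝ (EuclideanSpace.single i (1 : ℝ)) v} ∪
        {v | t ≤ inner ℝ (-EuclideanSpace.single i (1 : ℝ)) v}) := by
    intro v hv
    by_contra hcon
    simp only [Set.mem_iUnion, Finset.mem_univ, exists_prop, true_and, not_exists, Set.mem_union,
      Set.mem_ofPred_eq, not_or, not_le, inner_neg_left, EuclideanSpace.inner_single_left] at hcon
    have h1 : ‖v‖ ≤ ∑ i : Fin d, |v i| := by
      have h2 := norm_sum_le Finset.univ fun i => v i • EuclideanSpace.single i (1 : ℝ)
      have h3 : ∑ i, v i • EuclideanSpace.single i (1 : ℝ) = v := by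
        have := (EuclideanSpace.basisFun (Fin d) ℝ).sum_repr v
        simpa using this
      rw [h3] at h2
      simpa [norm_smul] using h2
    have h4 : ∑ i : Fin d, |v i| ≤ ∑ i : Fin d, t := by
      refine Finset.sum_le_sum fun i _ => abs_le.2 ?_
      have := hcon i
      simp only [map_one, one_mul] at this
      constructor <;> linarith
    simp only [Finset.sum_const, Finset.card_univ, Fintype.card_fin, nsmul_eq_mul] at h4
    exact absurd hv (not_lt.2 (h1.trans h4))
  refine (measureReal_mono hsub (measure_ne_top _ _)).trans ?_
  refine (measureReal_biUnion_finset_le _ _).trans ?_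
  have h : ∀ i ∈ (Finset.univ : Finset (Fin d)), (stdGaussian (Vec d)).real
      ({v | t ≤ inner ℝ (EuclideanSpace.single i (1 : ℝ)) v} ∪
        {v | t ≤ inner ℝ (-EuclideanSpace.single i (1 : ℝ)) v}) ≤ 2 * Real.exp (1 / 2 - t) := by
    intro i _
    refine (measureReal_union_le _ _).trans ?_
    have h1 := stdGaussian_inner_ge_le (u := EuclideanSpace.single i (1 : ℝ)) (by simp) t
    have h2 := stdGaussian_inner_ge_le (u := -EuclideanSpace.single i (1 : ℝ)) (by simp) t
    linarith
  refine (Finset.sum_le_sum h).trans (le_of_eq ?_)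
  simp
  ring

end Gaussian

/-! ### Concentration for processes driven by independent inputs. -/

section Recursion

variable {Ω S E : Type*} [MeasurableSpace Ω] [MeasurableSpace S] [MeasurableSpace E]
  {μ : Measure Ω} {ν : Measure E} {V : ℕ → Ω → E}

/-- A process driven by independent inputs is independent of the next input. -/
theorem indepFun_of_recursion {H : ℕ → Ω → S} {G : S × E → S} (hG : Measurable G) (c : S)
    (h0 : H 0 = fun _ => c) (hstep : ∀ k ω, H (k + 1) ω = G (H k ω, V k ω))
    (hV : ∀ k, Measurable (V k)) (hi : iIndepFun V μ) (k : ℕ) :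
    Measurable (H k) ∧ IndepFun (H k) (V k) μ := by
  have hle : ∀ k, MeasurableSpace.comap (V k) inferInstance ≤ (inferInstance : MeasurableSpace Ω) :=
    fun k => (hV k).comap_le
  -- The state at time `k` is measurable with respect to the inputs of index below `k`.
  have hmeas : ∀ k, Measurable[⨆ i ∈ Set.Iio k, MeasurableSpace.comap (V i) inferInstance] (H k) := by
    intro k
    induction k with
    | zero => rw [h0]; exact measurable_const
    | succ k ih =>
      have e : H (k + 1) = fun ω => G (H k ω, V k ω) := funext (hstep k)
      rw [e]
      refine hG.comp (Measurable.prodMk ?_ ?_)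
      · exact ih.mono (biSup_mono fun i hi => lt_trans hi (Nat.lt_succ_self k)) le_rfl
      · exact (comap_measurable (V k)).mono
          (le_biSup (fun i => MeasurableSpace.comap (V i) inferInstance)
            (show k ∈ Set.Iio (k + 1) from Nat.lt_succ_self k)) le_rfl
  refine ⟨(hmeas k).mono (iSup₂_le fun i _ => hle i) le_rfl, ?_⟩
  have h := indep_iSup_of_disjoint hle hi (S := Set.Iio k) (T := {k}) (by simp)
  rw [iSup_singleton] at h
  exact indep_of_indep_of_le_left h (hmeas k).comap_le

/-- Fubini on the product law plays the role of conditioning on `H`. -/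
theorem lintegral_mul_le_of_indepFun [IsFiniteMeasure μ] [SFinite ν] {H : Ω → S} {W : Ω → E} (hH : Measurable H)
    (hW : Measurable W) (hi : IndepFun H W μ) (hν : μ.map W = ν) {p : S → ℝ≥0∞} (hp : Measurable p)
    {g : S × E → ℝ≥0∞} (hg : Measurable g) {c : ℝ≥0∞} (hc : ∀ x, ∫⁻ v, g (x, v) ∂ν ≤ c) :
    ∫⁻ ω, p (H ω) * g (H ω, W ω) ∂μ ≤ c * ∫⁻ ω, p (H ω) ∂μ := by
  have hmap := (indepFun_iff_map_prod_eq_prod_map_map hH.aemeasurable hW.aemeasurable).1 hi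
  rw [hν] at hmap
  have hm : Measurable fun q : S × E => p q.1 * g q := by fun_prop
  have e1 : ∫⁻ ω, p (H ω) * g (H ω, W ω) ∂μ =
      ∫⁻ q, p q.1 * g q ∂(μ.map fun ω => (H ω, W ω)) := by
    rw [lintegral_map hm (hH.prodMk hW)]
  have : IsFiniteMeasure (μ.map H) := Measure.isFiniteMeasure_map μ H
  rw [e1, hmap, lintegral_prod _ hm.aemeasurable]
  calc ∫⁻ x, ∫⁻ v, p x * g (x, v) ∂ν ∂(μ.map H) ≤ ∫⁻ x, c * p x ∂(μ.map H) := by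
        refine lintegral_mono fun x => ?_
        rw [lintegral_const_mul _ (by fun_prop), mul_comm]
        exact mul_le_mul_left (hc x) _
    _ = c * ∫⁻ ω, p (H ω) ∂μ := by
      rw [lintegral_const_mul _ hp, lintegral_map hp hH]

open Classical in
/-- If each step fails with conditional probability at most `1 / 16`, then at least half of `K`
steps fail with probability at most `2⁻ᴷ`. -/
theorem measure_half_bad_le [IsProbabilityMeasure μ] [IsProbabilityMeasure ν] {X : ℕ → Ω → S} {Φ : S × E → S}
    (hΦ : Measurable Φ) (x₀ : S) (h0 : ∀ ω, X 0 ω = x₀)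
    (hstep : ∀ k ω, X (k + 1) ω = Φ (X k ω, V k ω)) (hV : ∀ k, Measurable (V k))
    (hi : iIndepFun V μ) (hν : ∀ k, μ.map (V k) = ν) {Bad : Set (S × E)} (hB : MeasurableSet Bad)
    (hBad : ∀ x, ν {v | (x, v) ∈ Bad} ≤ 16⁻¹) (K : ℕ) :
    μ {ω | K ≤ 2 * ((Finset.range K).filter fun k => (X k ω, V k ω) ∈ Bad).card} ≤ 2⁻¹ ^ K := by
  -- Weight `9` for a failure and `1` otherwise: the conditional mean is at most `1 + 8/16 = 3/2`,
  -- while `K/2` failures give weight at least `9^{K/2} = 3^K`. Markov's inequality then yields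
  -- `2⁻ᴷ`.
  set Z : S × E → ℝ≥0∞ := fun q => 1 + Bad.indicator (fun _ => 8) q with hZ
  have hZm : Measurable Z := by
    have : Measurable (Bad.indicator fun _ => (8 : ℝ≥0∞)) := measurable_const.indicator hB
    fun_prop
  set M : ℕ → Ω → ℝ≥0∞ := fun k ω => ∏ i ∈ Finset.range k, Z (X i ω, V i ω) with hM
  -- The running product is adjoined to the state, so that it too is independent of the next input.
  have hG : Measurable fun q : (S × ℝ≥0∞) × E => (Φ (q.1.1, q.2), q.1.2 * Z (q.1.1, q.2)) := by
    fun_prop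
  have hrec := indepFun_of_recursion (μ := μ) (H := fun k ω => (X k ω, M k ω)) hG (x₀, 1)
    (by funext ω; simp [hM, h0]) (fun k ω => by simp [hM, Finset.prod_range_succ, hstep]) hV hi
  have hint : ∀ k, ∫⁻ ω, M k ω ∂μ ≤ (3 / 2) ^ k := by
    intro k
    induction k with
    | zero => simp [hM]
    | succ k ih =>
      have h1 := lintegral_mul_le_of_indepFun (ν := ν) (hrec k).1 (hV k) (hrec k).2 (hν k)
        (p := Prod.snd) measurable_snd (g := fun q => Z (q.1.1, q.2)) (by fun_prop) (c := 3 / 2) (by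
          intro x
          simp only [hZ]
          rw [lintegral_add_left measurable_const]
          have hset : ∀ v, Bad.indicator (fun _ => (8 : ℝ≥0∞)) (x.1, v) =
              {v | (x.1, v) ∈ Bad}.indicator (fun _ => 8) v := fun v => rfl
          simp only [hset]
          have hsec : MeasurableSet {v | (x.1, v) ∈ Bad} := measurable_prodMk_left hB
          rw [lintegral_indicator_const hsec]
          simp only [lintegral_const, measure_univ, mul_one]
          calc 1 + 8 * ν {v | (x.1, v) ∈ Bad} ≤ 1 + 8 * 16⁻¹ := by
                gcongr
                exact hBad x.1
            _ = 3 / 2 := by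
              rw [← ENNReal.toReal_eq_toReal_iff' (by finiteness) (by finiteness)]
              rw [ENNReal.toReal_add (by finiteness) (by finiteness)]
              norm_num)
      calc ∫⁻ ω, M (k + 1) ω ∂μ = ∫⁻ ω, M k ω * Z (X k ω, V k ω) ∂μ := by
            simp only [hM, Finset.prod_range_succ]
        _ ≤ 3 / 2 * ∫⁻ ω, M k ω ∂μ := h1
        _ ≤ 3 / 2 * (3 / 2) ^ k := by gcongr
        _ = (3 / 2) ^ (k + 1) := by ring
  have hsub : {ω | K ≤ 2 * ((Finset.range K).filter fun k => (X k ω, V k ω) ∈ Bad).card} ⊆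
      {ω | 3 ^ K ≤ M K ω} := by
    intro ω hω
    simp only [Set.mem_ofPred_eq] at hω ⊢
    have e : M K ω = 9 ^ ((Finset.range K).filter fun k => (X k ω, V k ω) ∈ Bad).card := by
      rw [← Finset.prod_const, Finset.prod_filter]
      refine Finset.prod_congr rfl fun i _ => ?_
      by_cases hb : (X i ω, V i ω) ∈ Bad
      · simp only [hZ, Set.indicator_of_mem hb, if_pos hb]
        norm_num
      · simp [hZ, hb]
    rw [e, show (9 : ℝ≥0∞) = 3 ^ 2 by norm_num, ← pow_mul]
    exact pow_le_pow_right₀ (by norm_num) hω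
  have hmk := mul_meas_ge_le_lintegral (μ := μ) (measurable_snd.comp (hrec K).1) (3 ^ K)
  have h3 : (3 : ℝ≥0∞) ^ K ≠ 0 := by positivity
  have h3' : (3 : ℝ≥0∞) ^ K ≠ ⊤ := by finiteness
  have hfin : 3 ^ K * μ {ω | 3 ^ K ≤ M K ω} ≤ 3 ^ K * 2⁻¹ ^ K := by
    refine hmk.trans ((hint K).trans (le_of_eq ?_))
    rw [← mul_pow, div_eq_mul_inv]
  exact (measure_mono hsub).trans ((ENNReal.mul_le_mul_iff_right h3 h3').1 hfin)

end Recursion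

end SaddleNGD

/-! ### From single blocks to the whole run. -/

namespace SaddleNGD

open scoped ENNReal

variable {P : Params} {A s θ : ℝ} {N d : ℕ} {f : Vec d → ℝ}

theorem gradient_eq_zero_of_isLocalMin {xs : Vec d} (h : IsLocalMin f xs) :
    gradient f xs = 0 := by
  rw [gradient, h.fderiv_eq_zero, map_zero]

/-- `x` is close to a local minimum of `f` around which `f` is strongly convex. -/
def IsNearMin (P : Params) (A s : ℝ) (f : Vec d → ℝ) (x : Vec d) : Prop :=
  ∃ xs : Vec d, IsLocalMin f xs ∧ ‖x - xs‖ ≤ A ^ 5 * s ∧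
    IsStronglyConvexOn P.α f (Metric.closedBall xs (2 * P.r))

theorem Scales.isNearMin_block (h : Scales P A s θ N) (hf : IsSmooth P.β f) {x v : Vec d}
    (hv : IsMild A s θ v) (hx : IsNearMin P A s f x) :
    IsNearMin P A s f (block f (s ^ 2) θ N x v) := by
  obtain ⟨xs, h1, h2, h3⟩ := hx
  exact ⟨xs, h1, h.norm_block_sub_le hf x v xs hv (gradient_eq_zero_of_isLocalMin h1) h3 h2, h3⟩

/-- The first strict-saddle alternative gives a gradient above the threshold. In the third, `α ‖x -
xs‖ ≤ ‖∇f(x)‖`, so a gradient of at most `A⁴ s` would put `x` within `A⁵ s` of the minimum. -/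
theorem Scales.gradient_or_saddle (h : Scales P A s θ N)
    (hs : IsStrictSaddle P.α P.γ P.ν P.r f) (hr : 0 ≤ P.r) {x : Vec d}
    (hx : ¬ IsNearMin P A s f x) :
    A ^ 4 * s ≤ ‖gradient f x‖ ∨ ‖gradient f x‖ ≤ A ^ 4 * s ∧ ∃ (u : Vec d) (l : ℝ),
      ‖u‖ = 1 ∧ l ≤ -P.γ ∧ hessian f x u = l • u := by
  have hA := h.hA
  rcases le_total (A ^ 4 * s) ‖gradient f x‖ with hg | hg
  · exact Or.inl hg
  rcases hs x with h1 | ⟨l, hl, hev⟩ | ⟨xs, hmin, hdist, hc⟩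
  · left
    refine le_trans ?_ h1
    have h2 := h.small_of_le (m := 5) (by norm_num)
    have h3 := h.ν_inv
    have h4 : A * (A ^ 4 * s) ≤ A * P.ν := by
      have : A * (A ^ 4 * s) = s * A ^ 5 := by ring
      linarith
    exact le_of_mul_le_mul_left h4 (by linarith)
  · refine Or.inr ⟨hg, ?_⟩
    obtain ⟨u, hu⟩ := hev.exists_hasEigenvector
    have hu0 : ‖u‖ ≠ 0 := norm_ne_zero_iff.2 hu.2
    refine ⟨‖u‖⁻¹ • u, l, ?_, hl, ?_⟩
    · rw [norm_smul, norm_inv, norm_norm, inv_mul_cancel₀ hu0]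
    · have : hessian f x u = l • u := hu.apply_eq_smul
      rw [map_smul, this, smul_comm]
  · refine absurd ⟨xs, hmin, ?_, hc⟩ hx
    have h1 := hc.mul_sq_le_inner (gradient_eq_zero_of_isLocalMin hmin)
      (hdist.trans (by linarith : P.r ≤ 2 * P.r))
    have h2 := real_inner_le_norm (gradient f x) (x - xs)
    have h3 := h.α_inv
    by_contra! hfar
    have hpos : 0 < ‖x - xs‖ := lt_of_le_of_lt (by have := h.s_pos; positivity) hfar
    have h4 : P.α * ‖x - xs‖ ≤ ‖gradient f x‖ := by
      refine le_of_mul_le_mul_right ?_ hpos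
      linarith [h1.trans h2, pow_two ‖x - xs‖, mul_assoc P.α ‖x - xs‖ ‖x - xs‖]
    have h5 : A * (P.α * ‖x - xs‖) ≤ A * (A ^ 4 * s) :=
      mul_le_mul_of_nonneg_left (h4.trans hg) (by linarith)
    have h6 : 1 * ‖x - xs‖ ≤ A * P.α * ‖x - xs‖ := by gcongr
    have h7 : A * (A ^ 4 * s) = A ^ 5 * s := by ring
    linarith

/-- The pairs of a starting point and a mild noise vector whose block fails to decrease `f`. -/
def failSet (A s θ : ℝ) (N : ℕ) (f : Vec d → ℝ) : Set (Vec d × Vec d) :=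
  {q | IsMild A s θ q.2 ∧ f q.1 - s ^ 2 < f (block f (s ^ 2) θ N q.1 q.2)}

theorem mem_failSet {x v : Vec d} : (x, v) ∈ failSet A s θ N f ↔
    IsMild A s θ v ∧ f x - s ^ 2 < f (block f (s ^ 2) θ N x v) := Iff.rfl

theorem measurableSet_failSet {β : ℝ} (hf : IsSmooth β f) :
    MeasurableSet (failSet A s θ N f) := by
  have h1 : Measurable f := hf.1.continuous.measurable
  have h2 : Measurable fun q : Vec d × Vec d => block f (s ^ 2) θ N q.1 q.2 :=
    hf.measurable_iterate (s ^ 2) θ N N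
  have h3 : MeasurableSet {q : Vec d × Vec d | (s ^ 2 + θ * ‖q.2‖) * A ^ 5 ≤ s} :=
    measurableSet_le (by fun_prop) measurable_const
  have h4 : MeasurableSet {q : Vec d × Vec d |
      f q.1 - s ^ 2 < f (block f (s ^ 2) θ N q.1 q.2)} :=
    measurableSet_lt (by fun_prop) (h1.comp h2)
  exact h3.inter h4

/-- Merges the two cases away from the minima: with a large gradient no mild vector fails, and at a
saddle the failing ones lie in the slab. -/
theorem Scales.block_of_not_isNearMin (h : Scales P A s θ N) (hP : P.Pos) (hf : P.Admits f)
    {x : Vec d} (hx : ¬ IsNearMin P A s f x) :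
    (∀ v, IsMild A s θ v → f (block f (s ^ 2) θ N x v) ≤ f x + s ^ 2 / 16) ∧
      stdGaussian (Vec d) {v | (x, v) ∈ failSet A s θ N f} ≤ 16⁻¹ := by
  obtain ⟨hss, hsm, hH, -⟩ := hf
  have hs := sq_nonneg s
  rcases h.gradient_or_saddle hss hP.2.2.2.1.le hx with hg | ⟨hg, u, l, hu, hl, hul⟩
  · constructor
    · intro v hv
      linarith [h.block_le_of_large_gradient hsm x v hv hg]
    · have : {v | (x, v) ∈ failSet A s θ N f} = ∅ := by
        refine Set.eq_empty_of_forall_notMem fun v hv => ?_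
        obtain ⟨hmild, hdec⟩ := mem_failSet.1 hv
        exact absurd hdec (not_lt.2 (h.block_le_of_large_gradient hsm x v hmild hg))
      rw [this, measure_empty]
      exact zero_le
  · constructor
    · intro v hv
      have h1 := h.block_le_of_small_gradient hsm x v hv hg
      have h2 : 0 ≤ s ^ 2 * ∑ i ∈ Finset.range (N - 1),
        ‖gradient f (iterate f (s ^ 2) θ N x (fun _ => v) (i + 1))‖ :=
        mul_nonneg hs (Finset.sum_nonneg fun i _ => norm_nonneg _)
      linarith
    · have hθ : 0 < θ := by
        have := h.hA
        have := h.s_pos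
        rw [h.hθ]
        positivity
      have hl0 : l ≠ 0 := by linarith [hP.2.1]
      have hslab := stdGaussian_slab_le hu (mul_ne_zero hl0 hθ.ne')
        (inner ℝ u (gradient f x) - l * s ^ 2 * inner ℝ u (normalizedGradient f x))
      refine le_trans (measure_mono ?_) hslab
      intro v hv
      obtain ⟨hmild, hdec⟩ := mem_failSet.1 hv
      have h1 := h.mem_slab_of_not_decrease hsm hH x v u hmild hg hl hu hul hdec
      rw [Set.mem_ofPred_eq, abs_mul, abs_of_pos hθ]
      exact h1

open Classical in
/-- If fewer than half of the blocks fail to decrease `f` away from the minima, then the last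
point is near a minimum. -/
theorem Scales.isNearMin_of_few_failures (h : Scales P A s θ N) (hP : P.Pos) (hf : P.Admits f)
    {K : ℕ} (hK : A ^ 2 ≤ K * s ^ 2) (X V : ℕ → Vec d)
    (hX : ∀ k, X (k + 1) = block f (s ^ 2) θ N (X k) (V k)) (hV : ∀ k < K, IsMild A s θ (V k))
    (hfew : 2 * ((Finset.range K).filter fun k => ¬ IsNearMin P A s f (X k) ∧
      (X k, V k) ∈ failSet A s θ N f).card < K) : IsNearMin P A s f (X K) := by
  by_contra hend
  have hA := h.hA
  have hs := h.s_pos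
  -- The neighbourhoods of the minima are absorbing, so a run ending outside them never entered one.
  have hnot : ∀ k ≤ K, ¬ IsNearMin P A s f (X k) := by
    intro k hk hnear
    have hstay : ∀ j, k ≤ j → j ≤ K → IsNearMin P A s f (X j) := by
      intro j hj
      induction j, hj using Nat.le_induction with
      | base => exact fun _ => hnear
      | succ j _ ih =>
        intro hjK
        rw [hX]
        exact h.isNearMin_block hf.2.1 (hV j (by omega)) (ih (by omega))
    exact hend (hstay K hk le_rfl)
  set F : ℕ → Prop := fun k => ¬ IsNearMin P A s f (X k) ∧ (X k, V k) ∈ failSet A s θ N f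
  -- A failure may raise `f` by `s² / 16` and forgoes the decrease `s²`, hence `17/16`. With at most
  -- `K/2` failures the net fall is at least `15/32 · K s² ≥ 15/32 · A²`, which exceeds `2B`.
  have hdesc : ∀ k ≤ K, f (X k) ≤ f (X 0) - k * s ^ 2 +
      17 / 16 * s ^ 2 * ((Finset.range k).filter F).card := by
    intro k
    induction k with
    | zero => simp
    | succ k ih =>
      intro hk
      have h1 := ih (by omega)
      have h2 := (h.block_of_not_isNearMin hP hf (hnot k (by omega))).1 (V k) (hV k (by omega))
      rw [← hX] at h2
      rw [Finset.range_add_one, Finset.filter_insert]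
      split_ifs with hF
      · rw [Finset.card_insert_of_notMem (by simp)]
        push_cast
        nlinarith
      · have h3 : f (X (k + 1)) ≤ f (X k) - s ^ 2 := by
          by_contra! hcon
          rw [hX] at hcon
          exact hF ⟨hnot k (by omega), hV k (by omega), hcon⟩
        push_cast
        linarith
  have h1 := hdesc K le_rfl
  have h2 : 2 * (((Finset.range K).filter F).card : ℝ) ≤ K := by exact_mod_cast hfew.le
  have h3 := (abs_le.1 (hf.2.2.2 (X 0))).2
  have h4 := (abs_le.1 (hf.2.2.2 (X K))).1
  have h5 := h.B_le
  have h6 := mul_le_mul_of_nonneg_left h2 (sq_nonneg s)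
  have h7 : 128 * A ≤ A ^ 2 := by nlinarith
  nlinarith

/-- With high probability, the iterate after `K` blocks is near a minimum. -/
theorem Scales.exists_event (h : Scales P A s θ N) (hP : P.Pos) (hf : P.Admits f) {K : ℕ} {ξ : ℝ}
    (hK : A ^ 2 ≤ K * s ^ 2) (hKξ : (2⁻¹ : ℝ) ^ K ≤ ξ / 2)
    (htail : K * (2 * d * Real.exp (1 / 2 - A ^ 2)) ≤ ξ / 2)
    (hmild : ∀ v : Vec d, ‖v‖ ≤ d * A ^ 2 → IsMild A s θ v) (x₀ : Vec d)
    {Ω : Type*} [MeasurableSpace Ω] (μ : Measure Ω) [IsProbabilityMeasure μ] (n : ℕ → Ω → Vec d)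
    (hn : ∀ t, HasLaw (n t) (stdGaussian (Vec d)) μ) (hi : iIndepFun n μ) :
    ∃ G : Set Ω, MeasurableSet G ∧ 1 - ξ ≤ μ.real G ∧
      ∀ ω ∈ G, IsNearMin P A s f (iterate f (s ^ 2) θ N x₀ (fun t => n t ω) (K * N)) := by
  classical
  have hN : 0 < N := by have := h.four_le_N; omega
  have hsm := hf.2.1
  -- Having a law gives only almost everywhere measurability; the block chain is run on measurable
  -- versions, and `S₃` collects the null discrepancy.
  choose V hVm hVae using fun k => (hn (k * N)).aemeasurable
  have hVlaw : ∀ k, μ.map (V k) = stdGaussian (Vec d) := fun k => by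
    rw [← Measure.map_congr (hVae k), (hn (k * N)).map_eq]
  have hVi : iIndepFun V μ := by
    have h1 : iIndepFun (fun k => n (k * N)) μ :=
      hi.precomp (g := fun k => k * N) 
        fun a b hab => Nat.eq_of_mul_eq_mul_right hN hab
    exact h1.congr hVae
  set X : ℕ → Ω → Vec d := fun k ω =>
    Nat.rec x₀ (fun i x => block f (s ^ 2) θ N x (V i ω)) k with hXdef
  have hXstep : ∀ k ω, X (k + 1) ω = block f (s ^ 2) θ N (X k ω) (V k ω) := fun k ω => rfl
  have hΦ : Measurable fun q : Vec d × Vec d => block f (s ^ 2) θ N q.1 q.2 :=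
    hsm.measurable_iterate (s ^ 2) θ N N
  have hfm := measurableSet_failSet (A := A) (s := s) (θ := θ) (N := N) hsm
  -- `U` stands in for the complement of `IsNearMin`: it contains that complement, is visibly
  -- measurable in `x`, and makes the bound on `Bad` hold by definition.
  set U : Set (Vec d) :=
    {x | stdGaussian (Vec d) {v | (x, v) ∈ failSet A s θ N f} ≤ 16⁻¹} with hU
  have hUm : MeasurableSet U :=
    measurableSet_le (measurable_measure_prodMk_left hfm) measurable_const
  set Bad : Set (Vec d × Vec d) := {q | q.1 ∈ U} ∩ failSet A s θ N f with hBaddef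
  have hBm : MeasurableSet Bad := (measurable_fst hUm).inter hfm
  have hBad : ∀ x, stdGaussian (Vec d) {v | (x, v) ∈ Bad} ≤ 16⁻¹ := by
    intro x
    by_cases hx : x ∈ U
    · exact (measure_mono fun v hv => hv.2).trans hx
    · have : {v | (x, v) ∈ Bad} = ∅ := Set.eq_empty_of_forall_notMem fun v hv => hx hv.1
      rw [this, measure_empty]
      exact zero_le
  have hhalf := measure_half_bad_le (X := X) hΦ x₀ (fun ω => rfl) hXstep hVm hVi hVlaw hBm hBad K
  set S₁ : Set Ω := {ω | K ≤ 2 * ((Finset.range K).filter fun k => (X k ω, V k ω) ∈ Bad).card}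
  set S₂ : Set Ω := ⋃ k ∈ Finset.range K, V k ⁻¹' {v | d * A ^ 2 < ‖v‖}
  set S₃ : Set Ω := ⋃ k, {ω | n (k * N) ω ≠ V k ω}
  have h₁ : μ.real S₁ ≤ ξ / 2 := by
    refine le_trans ?_ hKξ
    have hS₁ : μ S₁ ≤ 2⁻¹ ^ K := by convert hhalf
    have := ENNReal.toReal_mono (by finiteness) hS₁
    simpa [measureReal_def] using this
  have h₂ : μ.real S₂ ≤ ξ / 2 := by
    refine (measureReal_biUnion_finset_le _ _).trans ?_
    have hm : MeasurableSet {v : Vec d | d * A ^ 2 < ‖v‖} :=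
      measurableSet_lt measurable_const measurable_norm
    have : ∀ k ∈ Finset.range K, μ.real (V k ⁻¹' {v | d * A ^ 2 < ‖v‖}) ≤
        2 * d * Real.exp (1 / 2 - A ^ 2) := by
      intro k _
      rw [← map_measureReal_apply (hVm k) hm, hVlaw]
      exact stdGaussian_norm_gt_le _
    refine (Finset.sum_le_sum this).trans ?_
    simpa using htail
  have h₃ : μ.real S₃ = 0 := by
    have : μ S₃ = 0 := measure_iUnion_null fun k => hVae k
    rw [measureReal_def, this, ENNReal.toReal_zero]
  -- A measurable hull avoids proving the exceptional set measurable and has the same measure.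
  refine ⟨(toMeasurable μ (S₁ ∪ S₂ ∪ S₃))ᶜ, (measurableSet_toMeasurable _ _).compl, ?_, ?_⟩
  · rw [probReal_compl_eq_one_sub (measurableSet_toMeasurable _ _), measureReal_def,
      measure_toMeasurable, ← measureReal_def]
    have h4 := measureReal_union_le (μ := μ) (S₁ ∪ S₂) S₃
    have h5 := measureReal_union_le (μ := μ) S₁ S₂
    linarith
  · intro ω hω
    have hω' : ω ∉ S₁ ∪ S₂ ∪ S₃ := fun hc => hω (subset_toMeasurable _ _ hc)
    simp only [Set.mem_union, not_or] at hω'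
    obtain ⟨⟨hω₁, hω₂⟩, hω₃⟩ := hω'
    have hnV : ∀ k, n (k * N) ω = V k ω := by
      intro k
      by_contra hc
      exact hω₃ (Set.mem_iUnion.2 ⟨k, hc⟩)
    have hXit : ∀ k, iterate f (s ^ 2) θ N x₀ (fun t => n t ω) (k * N) = X k ω := by
      intro k
      induction k with
      | zero => rw [zero_mul]; rfl
      | succ k ih => rw [iterate_succ_mul, ih, hnV, hXstep]
    rw [hXit]
    refine h.isNearMin_of_few_failures hP hf hK (fun k => X k ω) (fun k => V k ω)
      (fun k => hXstep k ω) (fun k hk => hmild _ ?_) ?_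
    · by_contra! hc
      exact hω₂ (Set.mem_biUnion (Finset.mem_coe.2 (Finset.mem_range.2 hk)) hc)
    · refine lt_of_le_of_lt ?_ (not_le.1 hω₁)
      refine Nat.mul_le_mul_left 2 (Finset.card_le_card ?_)
      refine Finset.monotone_filter_right _ fun k _ hk => ?_
      exact ⟨(h.block_of_not_isNearMin hP hf hk.1).2, hk.2⟩

end SaddleNGD

/-! ### Choice of the parameters and absorption of logarithms. -/

namespace SaddleNGD

theorem two_le_add_inv {p : ℝ} (hp : 0 < p) : 2 ≤ p + p⁻¹ := by
  have h1 : p * p⁻¹ = 1 := mul_inv_cancel₀ hp.ne'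
  have h2 : 0 < p⁻¹ := inv_pos.2 hp
  nlinarith [sq_nonneg (p - p⁻¹)]

theorem one_le_mul_and_le_mul {x y : ℝ} (hx : 1 ≤ x) (hy : 1 ≤ y) :
    1 ≤ x * y ∧ x ≤ x * y ∧ y ≤ x * y :=
  ⟨one_le_mul_of_one_le_of_one_le hx hy, le_mul_of_one_le_right (by linarith) hy,
    le_mul_of_one_le_left (by linarith) hx⟩

/-- Every parameter and its inverse is bounded by `baseSize`. -/
theorem baseSize_bounds {P : Params} (hP : P.Pos) {d : ℕ} (hd : 1 ≤ d) {ξ : ℝ} (hξ : 0 < ξ)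
    (hξ1 : ξ < 1) :
    128 ≤ baseSize P d ξ ∧ 1 + Real.log d ≤ baseSize P d ξ ∧
    1 + Real.log (1 / ξ) ≤ baseSize P d ξ ∧
    ∀ p ∈ ({P.α, P.γ, P.ν, P.r, P.β, P.ρ, P.B} : Set ℝ), p + p⁻¹ ≤ baseSize P d ξ := by
  obtain ⟨hα, hγ, hν, hr, hβ, hρ, hB⟩ := hP
  have hd' : 0 ≤ Real.log d := Real.log_nonneg (by exact_mod_cast hd)
  have hξ' : 0 ≤ Real.log (1 / ξ) := Real.log_nonneg (by rw [le_div_iff₀ hξ]; linarith)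
  have a1 := two_le_add_inv hα
  have a2 := two_le_add_inv hγ
  have a3 := two_le_add_inv hν
  have a4 := two_le_add_inv hr
  have a5 := two_le_add_inv hβ
  have a6 := two_le_add_inv hρ
  have a7 := two_le_add_inv hB
  have b2 := one_le_mul_and_le_mul (by linarith : 1 ≤ P.α + P.α⁻¹) (by linarith : 1 ≤ P.γ + P.γ⁻¹)
  have b3 := one_le_mul_and_le_mul b2.1 (by linarith : 1 ≤ P.ν + P.ν⁻¹)
  have b4 := one_le_mul_and_le_mul b3.1 (by linarith : 1 ≤ P.r + P.r⁻¹)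
  have b5 := one_le_mul_and_le_mul b4.1 (by linarith : 1 ≤ P.β + P.β⁻¹)
  have b6 := one_le_mul_and_le_mul b5.1 (by linarith : 1 ≤ P.ρ + P.ρ⁻¹)
  have b7 := one_le_mul_and_le_mul b6.1 (by linarith : 1 ≤ P.B + P.B⁻¹)
  have b8 := one_le_mul_and_le_mul b7.1 (by linarith : 1 ≤ 1 + Real.log d)
  have b9 := one_le_mul_and_le_mul b8.1 (by linarith : 1 ≤ 1 + Real.log (1 / ξ))
  -- Each of the seven factors `p + p⁻¹` is at least `2`, which is the origin of `128 = 2⁷`.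
  have c2 := mul_le_mul a1 a2 (by norm_num) (by linarith)
  have c3 := mul_le_mul c2 a3 (by norm_num) (by linarith [b2.1])
  have c4 := mul_le_mul c3 a4 (by norm_num) (zero_le_one.trans b3.1)
  have c5 := mul_le_mul c4 a5 (by norm_num) (zero_le_one.trans b4.1)
  have c6 := mul_le_mul c5 a6 (by norm_num) (zero_le_one.trans b5.1)
  have c7 := mul_le_mul c6 a7 (by norm_num) (zero_le_one.trans b6.1)
  have t7 := b8.2.1.trans b9.2.1
  have t6 := b7.2.1.trans t7
  have t5 := b6.2.1.trans t6
  have t4 := b5.2.1.trans t5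
  have t3 := b4.2.1.trans t4
  have t2 := b3.2.1.trans t3
  rw [baseSize]
  refine ⟨(le_of_eq (by norm_num)).trans (c7.trans t7), b8.2.2.trans b9.2.1, b9.2.2, ?_⟩
  rintro p (rfl | rfl | rfl | rfl | rfl | rfl | rfl)
  · exact b2.2.1.trans t2
  · exact b2.2.2.trans t2
  · exact b3.2.2.trans t3
  · exact b4.2.2.trans t4
  · exact b5.2.2.trans t5
  · exact b6.2.2.trans t6
  · exact b7.2.2.trans t7

theorem one_add_pow_le_exp {t : ℝ} (ht : 0 ≤ t) (m : ℕ) (hm : 0 < m) :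
    (1 + t) ^ m ≤ m ^ m * Real.exp t := by
  have hm' : (1 : ℝ) ≤ m := by exact_mod_cast hm
  have h1 : 1 + t ≤ m * Real.exp (t / m) := by
    have h2 := Real.add_one_le_exp (t / m)
    calc 1 + t ≤ m * (t / m + 1) := by
          rw [mul_add, mul_div_cancel₀ _ (by positivity)]
          linarith
      _ ≤ m * Real.exp (t / m) := by gcongr
  calc (1 + t) ^ m ≤ (m * Real.exp (t / m)) ^ m := by gcongr
    _ = m ^ m * Real.exp t := by
      rw [mul_pow, ← Real.exp_nat_mul, mul_div_cancel₀ _ (by positivity)]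

/-- Below the largest learning rate, `η d²` is small compared with any negative power of the
hidden factor, provided the constant `C = c ^ (2 m)` is large. -/
theorem mul_pow_le_one_of_lt_etaMax {m : ℕ} (hm : 0 < m) {c : ℝ} (hc : 1 ≤ c)
    (hcm : m * (3 + 2 * m + 2 * m * c) ≤ c ^ 2) {P : Params} (hP : P.Pos) {d : ℕ} (hd : 1 ≤ d)
    {ξ : ℝ} (hξ : 0 < ξ) (hξ1 : ξ < 1) {η : ℝ} (hη : 0 < η)
    (hlt : η < etaMax (c ^ (2 * m)) (2 * m) P d ξ) :
    η * d ^ 2 * (baseSize P d ξ * (1 + Real.log (1 / η))) ^ m ≤ 1 := by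
  obtain ⟨hM128, hMd, -, -⟩ := baseSize_bounds hP hd hξ hξ1
  set M := baseSize P d ξ
  have hM : 0 < M := by linarith
  have hd0 : (1 : ℝ) ≤ d := by exact_mod_cast hd
  set D : ℝ := c ^ (2 * m) * M ^ (2 * m) * (d : ℝ) ^ 2 with hD
  have hDpos : 0 < D := by positivity
  rw [etaMax, ← hD, lt_div_iff₀ hDpos] at hlt
  -- The bound on `η` contains no `log (1/η)`. Its slack `y ≥ 1` pays for that logarithm: `1 + log
  -- (1/η)` is at most a constant times `M (1 + log y)`, and `(1 + log y)^m ≤ m^m y`.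
  set y := 1 / (η * D) with hy
  have hy1 : 1 ≤ y := by rw [hy, le_div_iff₀ (by positivity)]; linarith
  have hlogy : 0 ≤ Real.log y := Real.log_nonneg hy1
  have e1 : 1 / η = D * y := by rw [hy]; field_simp
  have hlog : Real.log (1 / η) =
      2 * m * Real.log c + 2 * m * Real.log M + 2 * Real.log d + Real.log y := by
    rw [e1, Real.log_mul (by positivity) (by positivity), hD,
      Real.log_mul (by positivity) (by positivity), Real.log_mul (by positivity) (by positivity),
      Real.log_pow, Real.log_pow, Real.log_pow]
    push_cast
    ring
  have hlc : Real.log c ≤ c := (Real.log_le_sub_one_of_pos (by linarith)).trans (by linarith)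
  have hlM : Real.log M ≤ M := (Real.log_le_sub_one_of_pos hM).trans (by linarith)
  have hm0 : (0 : ℝ) ≤ m := Nat.cast_nonneg m
  have hb : 1 + Real.log (1 / η) ≤ (3 + 2 * m + 2 * m * c) * M * (1 + Real.log y) := by
    have h1 : 2 * m * Real.log c ≤ 2 * m * c * M := by
      calc 2 * m * Real.log c ≤ 2 * m * c := by gcongr
        _ ≤ 2 * m * c * M := le_mul_of_one_le_right (by positivity) (by linarith)
    have h2 : 2 * m * Real.log M ≤ 2 * m * M := by gcongr
    have h3 : 1 ≤ (3 + 2 * m + 2 * m * c) * M := by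
      have : 0 ≤ 2 * m + 2 * m * c := by positivity
      nlinarith
    have h4 : Real.log y ≤ (3 + 2 * m + 2 * m * c) * M * Real.log y :=
      le_mul_of_one_le_left hlogy h3
    rw [hlog]
    linarith
  have hΛ : 0 ≤ 1 + Real.log (1 / η) := by
    rw [e1, Real.log_mul (by positivity) (by positivity)]
    have : 0 ≤ Real.log D := by
      refine Real.log_nonneg ?_
      rw [hD]
      have h1 : 1 ≤ c ^ (2 * m) := one_le_pow₀ hc
      have h2 : 1 ≤ M ^ (2 * m) := one_le_pow₀ (by linarith)
      have h3 : (1 : ℝ) ≤ (d : ℝ) ^ 2 := one_le_pow₀ hd0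
      exact one_le_mul_of_one_le_of_one_le (one_le_mul_of_one_le_of_one_le h1 h2) h3
    linarith
  have hpow : (M * (1 + Real.log (1 / η))) ^ m ≤ c ^ (2 * m) * M ^ (2 * m) * y := by
    calc (M * (1 + Real.log (1 / η))) ^ m
        ≤ (M * ((3 + 2 * m + 2 * m * c) * M * (1 + Real.log y))) ^ m := by gcongr
      _ = (3 + 2 * m + 2 * m * c) ^ m * M ^ (2 * m) * (1 + Real.log y) ^ m := by
        rw [mul_pow, mul_pow, mul_pow, two_mul m, pow_add]
        ring
      _ ≤ (3 + 2 * m + 2 * m * c) ^ m * M ^ (2 * m) * (m ^ m * Real.exp (Real.log y)) := by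
        gcongr
        exact one_add_pow_le_exp hlogy m hm
      _ = (m * (3 + 2 * m + 2 * m * c)) ^ m * M ^ (2 * m) * y := by
        rw [Real.exp_log (by linarith), mul_pow]
        ring
      _ ≤ (c ^ 2) ^ m * M ^ (2 * m) * y := by gcongr
      _ = c ^ (2 * m) * M ^ (2 * m) * y := by rw [pow_mul c 2 m]
  calc η * d ^ 2 * (M * (1 + Real.log (1 / η))) ^ m
      ≤ η * d ^ 2 * (c ^ (2 * m) * M ^ (2 * m) * y) := by gcongr
    _ = (η * D) * y := by rw [hD]; ring
    _ = 1 := by rw [hy]; field_simp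

theorem sq_rpow_neg_half {s : ℝ} (hs : 0 < s) : (s ^ 2) ^ (-(1 / 2) : ℝ) = s⁻¹ := by
  rw [← Real.rpow_natCast, ← Real.rpow_mul hs.le]
  norm_num [Real.rpow_neg_one]

theorem sq_rpow_neg_three_halves {s : ℝ} (hs : 0 < s) :
    (s ^ 2) ^ (-(3 / 2) : ℝ) = (s ^ 3)⁻¹ := by
  rw [← Real.rpow_natCast, ← Real.rpow_mul hs.le]
  norm_num [Real.rpow_neg hs.le]

theorem exp_neg_le_half {A ξ : ℝ} (hξ : 0 < ξ) (hA : 1 + Real.log (1 / ξ) ≤ A) :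
    Real.exp (-A) ≤ ξ / 2 := by
  calc Real.exp (-A) ≤ Real.exp (Real.log ξ - 1) := by
        rw [one_div, Real.log_inv] at hA
        exact Real.exp_le_exp.2 (by linarith)
    _ = ξ / Real.exp 1 := by rw [Real.exp_sub, Real.exp_log hξ]
    _ ≤ ξ / 2 := by
      gcongr
      linarith [Real.add_one_le_exp 1]

theorem two_inv_pow_le {A : ℝ} {K : ℕ} (hK : 2 * A ≤ K) : (2⁻¹ : ℝ) ^ K ≤ Real.exp (-A) := by
  have h1 : (2⁻¹ : ℝ) ≤ Real.exp (-(1 / 2)) := by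
    linarith [Real.add_one_le_exp (-(1 / 2) : ℝ)]
  calc (2⁻¹ : ℝ) ^ K ≤ Real.exp (-(1 / 2)) ^ K := by gcongr
    _ = Real.exp (K * (-(1 / 2))) := by rw [← Real.exp_nat_mul]
    _ ≤ Real.exp (-A) := Real.exp_le_exp.2 (by linarith)

/-- Both `K` and `d` are at most polynomial in `e^A`, so `e^{-A²}` beats the union bound over blocks
and coordinates. -/
theorem tail_le {A s : ℝ} {d K : ℕ} (hA : 128 ≤ A) (hd : (d : ℝ) ≤ Real.exp A)
    (hexp : Real.exp (-A) ≤ s) (hK : K * s ^ 2 ≤ 2 * A ^ 2) :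
    K * (2 * d * Real.exp (1 / 2 - A ^ 2)) ≤ Real.exp (-A) := by
  have hAe : A ≤ Real.exp A := by linarith [Real.add_one_le_exp A]
  have hs1 : 1 ≤ Real.exp A * s := by
    have : Real.exp A * Real.exp (-A) = 1 := by rw [← Real.exp_add]; simp
    rw [← this]
    gcongr
  have hK' : (K : ℝ) ≤ 2 * Real.exp A ^ 4 := by
    calc (K : ℝ) = K * 1 ^ 2 := by ring
      _ ≤ K * (Real.exp A * s) ^ 2 := by gcongr
      _ = Real.exp A ^ 2 * (K * s ^ 2) := by ring
      _ ≤ Real.exp A ^ 2 * (2 * A ^ 2) := by gcongr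
      _ ≤ Real.exp A ^ 2 * (2 * Real.exp A ^ 2) := by gcongr
      _ = 2 * Real.exp A ^ 4 := by ring
  calc K * (2 * d * Real.exp (1 / 2 - A ^ 2))
      ≤ (2 * Real.exp A ^ 4) * (2 * Real.exp A * Real.exp (1 / 2 - A ^ 2)) := by gcongr
    _ = 4 * (Real.exp A ^ 5 * Real.exp (1 / 2 - A ^ 2)) := by ring
    _ ≤ Real.exp A * (Real.exp A ^ 5 * Real.exp (1 / 2 - A ^ 2)) := by
      gcongr
      linarith
    _ = Real.exp (6 * A + (1 / 2 - A ^ 2)) := by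
      rw [Real.exp_add, show 6 * A = (6 : ℕ) * A by norm_num, Real.exp_nat_mul]
      ring
    _ ≤ Real.exp (-A) := Real.exp_le_exp.2 (by nlinarith)

theorem exists_nat_mul_mem {a b : ℝ} (ha : 0 < a) (ha1 : a ≤ b) :
    ∃ n : ℕ, b ≤ n * a ∧ n * a ≤ 2 * b := by
  refine ⟨⌈b / a⌉₊, ?_, ?_⟩
  · rw [← div_le_iff₀ ha]
    exact Nat.le_ceil _
  · have h1 := (Nat.ceil_lt_add_one (div_nonneg (ha.le.trans ha1) ha.le : 0 ≤ b / a)).le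
    calc (⌈b / a⌉₊ : ℝ) * a ≤ (b / a + 1) * a := by gcongr
      _ = b + a := by field_simp
      _ ≤ 2 * b := by linarith

/-- The choice of the parameters, in terms of a size `A` and the square root `s` of the learning
rate. -/
theorem exists_parameters {P : Params} (hP : P.Pos) {d : ℕ} (hd : 1 ≤ d) {ξ : ℝ} (hξ : 0 < ξ)
    {A L s : ℝ} (hA : 128 ≤ A) (hs : 0 < s) (hs1 : s ≤ 1) (hsd : s * d * A ^ 20 ≤ 1)
    (hexp : Real.exp (-A) ≤ s) (hlogd : 1 + Real.log d ≤ A) (hξA : 1 + Real.log (1 / ξ) ≤ A)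
    (hple : ∀ p ∈ ({P.α, P.γ, P.ν, P.r, P.β, P.ρ, P.B} : Set ℝ), 0 < p → p ≤ A ∧ 1 ≤ A * p)
    (hLpow : ∀ m ≤ 20, A ^ m ≤ L) :
    ∃ (θ : ℝ) (N₀ Ttot : ℕ),
      IsTildeTheta L θ (s ^ 2) ∧ IsTildeTheta L (N₀ : ℝ) ((s ^ 2) ^ (-(1 / 2) : ℝ)) ∧
      IsTildeO L (Ttot : ℝ) ((s ^ 2) ^ (-(3 / 2) : ℝ)) ∧
      ∀ (f : Vec d → ℝ), P.Admits f → ∀ (x₀ : Vec d),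
      ∀ (Ω : Type*) [MeasurableSpace Ω] (μ : Measure Ω) [IsProbabilityMeasure μ]
        (n : ℕ → Ω → Vec d),
        (∀ t, HasLaw (n t) (stdGaussian (Vec d)) μ) → iIndepFun n μ →
        ∃ G : Set Ω, MeasurableSet G ∧ 1 - ξ ≤ μ.real G ∧
          ∀ ω ∈ G, ∃ xs : Vec d, IsLocalMin f xs ∧
            (∃ t ≤ Ttot, IsTildeO L
              ‖iterate f (s ^ 2) θ N₀ x₀ (fun s => n s ω) t - xs‖ (Real.sqrt (s ^ 2))) ∧
            IsTildeO L
              (f (iterate f (s ^ 2) θ N₀ x₀ (fun s => n s ω) Ttot) - f xs) (s ^ 2) := by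
  obtain ⟨hα, hγ, hν, hr, hβ, hρ, hB⟩ := id hP
  have hA1 : 1 ≤ A := by linarith
  have hd1 : (1 : ℝ) ≤ d := by exact_mod_cast hd
  have hL1 : 1 ≤ L := by simpa using hLpow 0 (by norm_num)
  have hsA : s * A ^ 20 ≤ 1 := by
    refine le_trans ?_ hsd
    gcongr
    exact le_mul_of_one_le_right hs.le hd1
  have hA2 : (1 : ℝ) ≤ A ^ 2 := one_le_pow₀ hA1
  have hs2 : s ^ 2 ≤ 1 := pow_le_one₀ hs.le hs1
  obtain ⟨N, hN1, hN2⟩ := exists_nat_mul_mem hs (by linarith : s ≤ A ^ 2)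
  obtain ⟨K, hK1, hK2⟩ := exists_nat_mul_mem (by positivity : 0 < s ^ 2)
    (hs2.trans hA2)
  have hsc : Scales P A s (A ^ 8 * s ^ 2) N :=
    { hA := hA
      hβ := hβ
      hρ := hρ
      α_inv := (hple _ (by simp) hα).2
      γ_inv := (hple _ (by simp) hγ).2
      γ_le := (hple _ (by simp) hγ).1
      ν_inv := (hple _ (by simp) hν).2
      r_inv := (hple _ (by simp) hr).2
      β_le := (hple _ (by simp) hβ).1
      ρ_le := (hple _ (by simp) hρ).1
      B_le := (hple _ (by simp) hB).1
      s_pos := hs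
      hθ := rfl
      le_N := hN1
      N_le := hN2
      small := hsA
      exp_le := hexp }
  have h4A : 4 ≤ A := by linarith
  have hdA : (d : ℝ) ≤ Real.exp A := by
    rw [← Real.log_le_iff_le_exp (by exact_mod_cast hd)]
    linarith
  have hξA' := exp_neg_le_half hξ hξA
  -- With `θ = A⁸ s²` the condition reads `s A⁵ + s d A¹⁵ ≤ 1`; here the factor `d` in `hsd` is
  -- used.
  have hmild : ∀ v : Vec d, ‖v‖ ≤ d * A ^ 2 → IsMild A s (A ^ 8 * s ^ 2) v := by
    intro v hv
    have h1 : A ^ 8 * s ^ 2 * ‖v‖ ≤ A ^ 8 * s ^ 2 * (d * A ^ 2) := by gcongr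
    have h2 := hsc.small_of_le (m := 5) (by norm_num)
    have h3 : s * d * A ^ 15 * 2 ≤ 1 := by
      calc s * d * A ^ 15 * 2 ≤ s * d * A ^ 15 * A ^ 5 := by
            gcongr
            calc (2 : ℝ) ≤ A := by linarith
              _ ≤ A ^ 5 := le_self_pow₀ hA1 (by norm_num)
        _ = s * d * A ^ 20 := by ring
        _ ≤ 1 := hsd
    rw [IsMild]
    calc (s ^ 2 + A ^ 8 * s ^ 2 * ‖v‖) * A ^ 5
        ≤ (s ^ 2 + A ^ 8 * s ^ 2 * (d * A ^ 2)) * A ^ 5 := by gcongr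
      _ = s * (s * A ^ 5 + s * d * A ^ 15) := by ring
      _ ≤ s * 1 := by
        gcongr
        linarith
      _ = s := mul_one s
  refine ⟨A ^ 8 * s ^ 2, N, K * N, ⟨?_, ?_⟩, ⟨?_, ?_⟩, ?_, ?_⟩
  · calc s ^ 2 / L ≤ s ^ 2 := div_le_self (by positivity) hL1
      _ ≤ A ^ 8 * s ^ 2 := le_mul_of_one_le_left (by positivity) (one_le_pow₀ hA1)
  · gcongr
    exact hLpow 8 (by norm_num)
  · rw [sq_rpow_neg_half hs]
    calc s⁻¹ / L ≤ s⁻¹ := div_le_self (by positivity) hL1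
      _ ≤ N := by
        rw [inv_le_iff_one_le_mul₀ hs]
        linarith
  · rw [sq_rpow_neg_half hs, ← div_eq_mul_inv, le_div_iff₀ hs]
    calc N * s ≤ 2 * A ^ 2 := hN2
      _ ≤ A * A ^ 2 := by gcongr; linarith
      _ = A ^ 3 := by ring
      _ ≤ L := hLpow 3 (by norm_num)
  · rw [IsTildeO, sq_rpow_neg_three_halves hs, ← div_eq_mul_inv, le_div_iff₀ (by positivity)]
    calc ((K * N : ℕ) : ℝ) * s ^ 3 = (K * s ^ 2) * (N * s) := by push_cast; ring
      _ ≤ (2 * A ^ 2) * (2 * A ^ 2) := by gcongr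
      _ = 4 * A ^ 4 := by ring
      _ ≤ A * A ^ 4 := by gcongr
      _ = A ^ 5 := by ring
      _ ≤ L := hLpow 5 (by norm_num)
  intro f hf x₀ Ω _ μ _ n hn hi
  have hKA : 2 * A ≤ K := by
    have h1 : (K : ℝ) * s ^ 2 ≤ K * 1 := by gcongr
    nlinarith
  obtain ⟨G, hG, hGξ, hGmin⟩ := hsc.exists_event hP hf hK1 ((two_inv_pow_le hKA).trans hξA')
    ((tail_le hA hdA hexp hK2).trans hξA') hmild x₀ μ n hn hi
  refine ⟨G, hG, hGξ, fun ω hω => ?_⟩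
  obtain ⟨xs, hmin, hdist, -⟩ := hGmin ω hω
  -- The final time itself witnesses the distance claim; the value claim is the descent lemma at the
  -- critical point `xs`.
  refine ⟨xs, hmin, ⟨K * N, le_rfl, ?_⟩, ?_⟩
  · rw [IsTildeO, Real.sqrt_sq hs.le]
    refine hdist.trans ?_
    gcongr
    exact hLpow 5 (by norm_num)
  · have h1 := (abs_le.1 (hf.2.1.abs_sub_sub_inner_le hβ.le xs
      (iterate f (s ^ 2) (A ^ 8 * s ^ 2) N x₀ (fun t => n t ω) (K * N)))).2
    rw [gradient_eq_zero_of_isLocalMin hmin, inner_zero_left, sub_zero] at h1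
    rw [IsTildeO]
    refine h1.trans ?_
    calc _ ≤ A * (A ^ 5 * s) ^ 2 := by
          gcongr
          exact (hple _ (by simp) hβ).1
      _ = A ^ 11 * s ^ 2 := by ring
      _ ≤ L * s ^ 2 := by
        gcongr
        exact hLpow 11 (by norm_num)

end SaddleNGD

theorem theorem1 :
    ∃ (C : ℝ) (k : ℕ), 1 ≤ C ∧
      ∀ (P : Params), P.Pos → ∀ (d : ℕ), 1 ≤ d →
      ∀ (ξ : ℝ), 0 < ξ → ξ < 1 →
      ∀ (η : ℝ), 0 < η → η < etaMax C k P d ξ →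
      ∃ (θ : ℝ) (N₀ Ttot : ℕ),
        IsTildeTheta (tildeFactor C k P d ξ η) θ η ∧
        IsTildeTheta (tildeFactor C k P d ξ η) (N₀ : ℝ) (η ^ (-(1 / 2) : ℝ)) ∧
        IsTildeO (tildeFactor C k P d ξ η) (Ttot : ℝ) (η ^ (-(3 / 2) : ℝ)) ∧
        ∀ (f : Vec d → ℝ), P.Admits f → ∀ (x₀ : Vec d),
        ∀ (Ω : Type*) [MeasurableSpace Ω] (μ : Measure Ω) [IsProbabilityMeasure μ]
          (n : ℕ → Ω → Vec d),
          (∀ t, HasLaw (n t) (stdGaussian (Vec d)) μ) → iIndepFun n μ →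
          ∃ G : Set Ω, MeasurableSet G ∧ 1 - ξ ≤ μ.real G ∧
            ∀ ω ∈ G, ∃ xs : Vec d, IsLocalMin f xs ∧
              (∃ t ≤ Ttot, IsTildeO (tildeFactor C k P d ξ η)
                ‖iterate f η θ N₀ x₀ (fun s => n s ω) t - xs‖ (Real.sqrt η)) ∧
              IsTildeO (tildeFactor C k P d ξ η)
                (f (iterate f η θ N₀ x₀ (fun s => n s ω) Ttot) - f xs) η := by
  -- The exponent `40` is twice the `20` needed for `s = √η`, and `c = 4000` satisfies `40 (83 + 80
  -- c) ≤ c²`.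
  refine ⟨4000 ^ (2 * 40), 2 * 40, one_le_pow₀ (by norm_num), ?_⟩
  intro P hP d hd ξ hξ hξ1 η hη hlt
  have hsmall := mul_pow_le_one_of_lt_etaMax (m := 40) (c := 4000) (by norm_num) (by norm_num)
    (by norm_num) hP hd hξ hξ1 hη hlt
  obtain ⟨hM, hMd, hMξ, hMp⟩ := baseSize_bounds hP hd hξ hξ1
  have hd1 : (1 : ℝ) ≤ d := by exact_mod_cast hd
  have hη1 : η ≤ 1 := by
    refine hlt.le.trans ?_
    rw [etaMax]
    refine div_le_one_of_le₀ ?_ (by positivity)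
    exact one_le_mul_of_one_le_of_one_le (one_le_mul_of_one_le_of_one_le
      (one_le_pow₀ (by norm_num)) (one_le_pow₀ (by linarith))) (one_le_pow₀ hd1)
  have hlogη : 0 ≤ Real.log (1 / η) := Real.log_nonneg (by rw [le_div_iff₀ hη]; linarith)
  obtain ⟨-, hMA, hΛA⟩ := one_le_mul_and_le_mul (by linarith : 1 ≤ baseSize P d ξ)
    (by linarith : 1 ≤ 1 + Real.log (1 / η))
  have hLpow : ∀ m ≤ 20, (baseSize P d ξ * (1 + Real.log (1 / η))) ^ m ≤
      tildeFactor (4000 ^ (2 * 40)) (2 * 40) P d ξ η := by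
    intro m hm
    rw [tildeFactor]
    exact (pow_le_pow_right₀ (by linarith) (by omega)).trans
      (le_mul_of_one_le_left (pow_nonneg (by linarith) _) (one_le_pow₀ (by norm_num)))
  generalize tildeFactor (4000 ^ (2 * 40)) (2 * 40) P d ξ η = L at hLpow ⊢
  generalize baseSize P d ξ * (1 + Real.log (1 / η)) = A at *
  have hple : ∀ p ∈ ({P.α, P.γ, P.ν, P.r, P.β, P.ρ, P.B} : Set ℝ), 0 < p → p ≤ A ∧ 1 ≤ A * p := by
    intro p hp hp0
    have h1 := hMp p hp
    have h2 : 0 < p⁻¹ := inv_pos.2 hp0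
    refine ⟨by linarith, ?_⟩
    calc 1 = p⁻¹ * p := (inv_mul_cancel₀ hp0.ne').symm
      _ ≤ A * p := by
        gcongr
        linarith
  obtain ⟨s, hs, rfl⟩ : ∃ s : ℝ, 0 < s ∧ s ^ 2 = η :=
    ⟨√η, Real.sqrt_pos.2 hη, Real.sq_sqrt hη.le⟩
  have hs1 : s ≤ 1 := by nlinarith
  refine exists_parameters hP hd hξ (by linarith) hs hs1 ?_ ?_ (hMd.trans hMA) (hMξ.trans hMA)
    hple hLpow
  · have h1 : (s * d * A ^ 20) ^ 2 ≤ 1 := by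
      calc (s * d * A ^ 20) ^ 2 = s ^ 2 * d ^ 2 * A ^ 40 := by ring
        _ ≤ 1 := hsmall
    have hA0 : 0 ≤ A := by linarith
    exact (sq_le_one_iff₀ (by positivity)).1 h1
  · calc Real.exp (-A) ≤ Real.exp (Real.log (s ^ 2)) := by
          rw [one_div, Real.log_inv] at hΛA
          exact Real.exp_le_exp.2 (by linarith)
      _ = s ^ 2 := Real.exp_log (by positivity)
      _ ≤ s := by nlinarith
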